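/- Let $N$ be a connected and simply connected nilpotent real Lie group with Lie algebra $\mathfrak n$, and let $\Gamma$ and $\Lambda$ be lattices in $N$. A basis $X_1,\dots,X_n$ of $\mathfrak n$ is a strong Malcev basis if $\operatorname{span}_{\mathbb R}\{X_1,\dots,X_i\}$ is an ideal of $\mathfrak n$ for every $i$; it is strongly based on $\Gamma$ if moreover $\Gamma=e^{\mathbb ZX_1}\cdots e^{\mathbb ZX_n}$. A real number $a$ is Diophantine if there are constants $C,\tau>0$ such that $|ka-p|\ge C|k|^{-\tau}$ for all $k\in\mathbb Z\setminus\{0\}$ and all $p\in\mathbb Z$. Say that $\Lambda$ is Diophantine with respect to $\Gamma$ if there exist a strong Malcev basis $X_1,\dots,X_n$ strongly based on $\Gamma$ and a strong Malcev basis $Y_1,\dots,Y_n$ strongly based on $\Lambda$ such that $Y_i=\sum_{j=1}^i a_{ij}X_j$ for every $1\le i\le n$, with $a_{ij}\in\mathbb R$ and every $a_{ii}$ Diophantine. Suppose that $\Lambda$ is Diophantine with respect to $\Gamma$. Let $\Lambda$ act on $\Gamma\backslash N$ by right multiplication, and let $c:\Gamma\backslash N\times\Lambda\to\mathbb R$ be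 a $C^\infty$ cocycle over this action, that is, $c(\cdot,\lambda)$ is $C^\infty$ for every $\lambda\in\Lambda$ and $$c(x,\lambda\lambda')=c(x,\lambda)+c(x\lambda,\lambda')\qquad(x\in\Gamma\backslash N,\ \lambda,\lambda'\in\Lambda).$$ Then $c$ is cohomologous to a constant cocycle: there exist a homomorphism $\varphi:\Lambda\to\mathbb R$ and a $C^\infty$ function $P:\Gamma\backslash N\to\mathbb R$ such that $$c(x,\lambda)=-P(x)+\varphi(\lambda)+P(x\lambda)\qquad(x\in\Gamma\backslash N,\ \lambda\in\Lambda).$$ -/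

import Mathlib

open scoped Manifold ContDiff
open MeasureTheory

namespace DiophantineLattice

noncomputable section

section Exponential

variable {E : Type*} [NormedAddCommGroup E] [NormedSpace ℝ E]
  {N : Type*} [TopologicalSpace N] [ChartedSpace E N] [Group N] [LieGroup 𝓘(ℝ, E) ∞ N]

theorem contMDiff_invariantField (X : GroupLieAlgebra 𝓘(ℝ, E) N) :
    ContMDiff 𝓘(ℝ, E) 𝓘(ℝ, E).tangent 1
      (fun g : N => (⟨g, mulInvariantVectorField X g⟩ : TangentBundle 𝓘(ℝ, E) N)) := by
  have : LieGroup 𝓘(ℝ, E) (minSmoothness ℝ 3) N := by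
    rw [minSmoothness_of_isRCLikeNormedField]; infer_instance
  have h := contMDiff_mulInvariantVectorField X
  exact h.of_le (one_le_two.trans le_minSmoothness)

theorem mulInvariantVectorField_mul (X : GroupLieAlgebra 𝓘(ℝ, E) N) (x g : N) :
    mulInvariantVectorField X (x * g) =
      mfderiv 𝓘(ℝ, E) 𝓘(ℝ, E) (fun y : N => x * y) g (mulInvariantVectorField X g) := by
  have hd : ∀ a b : N, MDifferentiableAt 𝓘(ℝ, E) 𝓘(ℝ, E) (fun y : N => a * y) b := fun a b =>
    (contMDiff_mul_left (I := 𝓘(ℝ, E)) (n := ∞) (a := a)).mdifferentiable (by simp) b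
  have h : (fun y : N => x * g * y) = (fun y : N => x * y) ∘ (fun y : N => g * y) := by
    funext y; simp [mul_assoc]
  let F : N → (E →L[ℝ] E) := fun b => mfderiv 𝓘(ℝ, E) 𝓘(ℝ, E) (fun y : N => x * y) b
  have h2 : mulInvariantVectorField X (x * g) = F (g * 1) (mulInvariantVectorField X g) := by
    unfold mulInvariantVectorField
    rw [h, mfderiv_comp (I' := 𝓘(ℝ, E)) (1 : N) (hd x (g * 1)) (hd g 1)]
    rfl
  rw [h2]
  exact congrArg (fun b => F b (mulInvariantVectorField X g)) (mul_one g)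

variable [FiniteDimensional ℝ E]

/-- Left-invariant vector fields are complete: the integral curve through the identity is
defined for all times. -/
theorem exists_integralCurve [T2Space N] (X : GroupLieAlgebra 𝓘(ℝ, E) N) :
    ∃ γ : ℝ → N, γ 0 = 1 ∧ IsMIntegralCurve γ (mulInvariantVectorField X) := by
  have : CompleteSpace E := FiniteDimensional.complete ℝ E
  have : IsManifold 𝓘(ℝ, E) ∞ N := inferInstance
  have : IsManifold 𝓘(ℝ, E) 1 N := inferInstance
  have hX := contMDiff_invariantField (E := E) (N := N) X
  obtain ⟨γ, h0, hγ⟩ := exists_isMIntegralCurveAt_of_contMDiffAt_boundaryless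
    (t₀ := (0 : ℝ)) (hX.contMDiffAt (x := (1 : N)))
  obtain ⟨ε, hε, hγ⟩ := isMIntegralCurveAt_iff'.1 hγ
  refine exists_isMIntegralCurve_of_isMIntegralCurveOn hX hε (fun x => ?_) 1
  refine ⟨fun t => x * γ t, by simp [h0], fun t ht => ?_⟩
  have ht' : t ∈ Metric.ball (0 : ℝ) ε := by simpa [Real.ball_eq_Ioo] using ht
  have h1 := (hγ t ht').mono (s := Set.Ioo (-ε) ε) (by simp [Real.ball_eq_Ioo])
  have hd : MDifferentiableAt 𝓘(ℝ, E) 𝓘(ℝ, E) (fun y : N => x * y) (γ t) :=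
    (contMDiff_mul_left (I := 𝓘(ℝ, E)) (n := ∞) (a := x)).mdifferentiable (by simp) _
  have h2 := hd.hasMFDerivAt.comp_hasMFDerivWithinAt t h1
  have h3 : ContinuousLinearMap.smulRight (1 : ℝ →L[ℝ] ℝ) (mulInvariantVectorField X (x * γ t)) =
      (mfderiv 𝓘(ℝ, E) 𝓘(ℝ, E) (fun y : N => x * y) (γ t)).comp
        (ContinuousLinearMap.smulRight (1 : ℝ →L[ℝ] ℝ) (mulInvariantVectorField X (γ t))) := by
    rw [mulInvariantVectorField_mul]
    refine ContinuousLinearMap.ext fun r => ?_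
    exact ((mfderiv 𝓘(ℝ, E) 𝓘(ℝ, E) (fun y : N => x * y) (γ t)).map_smul r
      (mulInvariantVectorField X (γ t))).symm
  rw [h3]
  exact h2

/-- The exponential map of the Lie group `N`: `exp X` is the value at time one of the
one-parameter subgroup generated by `X`, that is, of the integral curve through the identity of
the left-invariant vector field defined by `X`. -/
def lieExp [T2Space N] (X : GroupLieAlgebra 𝓘(ℝ, E) N) : N :=
  (exists_integralCurve X).choose 1

/-- The characterization of the exponential map: it is computed by any integral curve. -/
theorem lieExp_eq [T2Space N] (X : GroupLieAlgebra 𝓘(ℝ, E) N) (γ : ℝ → N) (h0 : γ 0 = 1)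
    (hγ : IsMIntegralCurve γ (mulInvariantVectorField X)) : lieExp X = γ 1 := by
  have : CompleteSpace E := FiniteDimensional.complete ℝ E
  have : IsManifold 𝓘(ℝ, E) ∞ N := inferInstance
  have : IsManifold 𝓘(ℝ, E) 1 N := inferInstance
  have hs := (exists_integralCurve X).choose_spec
  exact congrFun (isMIntegralCurve_Ioo_eq_of_contMDiff_boundaryless (t₀ := 0)
    (contMDiff_invariantField X) hs.2 hγ (hs.1.trans h0.symm)) 1

end Exponential

section Lattice

/-- A lattice in a topological group: a discrete subgroup of finite covolume, i.e. the action of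
`Γ` by left multiplication has a fundamental domain of finite Haar measure. -/
structure IsLattice {N : Type*} [TopologicalSpace N] [Group N] (Γ : Subgroup N) : Prop where
  discrete : DiscreteTopology Γ
  finite_covolume : letI : MeasurableSpace N := borel N
    ∃ μ : Measure N, μ.IsHaarMeasure ∧ ∃ F : Set N, IsFundamentalDomain Γ F μ ∧ μ F < ⊤

/-- A real number `a` is Diophantine if there are `C, τ > 0` with `|k a - p| ≥ C |k| ^ (-τ)` for
all integers `k ≠ 0` and `p`. -/
def IsDiophantine (a : ℝ) : Prop :=
  ∃ C > (0 : ℝ), ∃ τ > (0 : ℝ), ∀ k : ℤ, k ≠ 0 → ∀ p : ℤ,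
    C * |(k : ℝ)| ^ (-τ) ≤ |(k : ℝ) * a - (p : ℝ)|

variable {E : Type*} [NormedAddCommGroup E] [NormedSpace ℝ E] [FiniteDimensional ℝ E]
  {N : Type*} [TopologicalSpace N] [ChartedSpace E N] [Group N] [LieGroup 𝓘(ℝ, E) ∞ N]

/-- `X_1, …, X_n` is a strong Malcev basis of the Lie algebra of `N`: for each `i` the span of
`X_1, …, X_i` is an ideal. -/
def IsStrongMalcevBasis {n : ℕ} (X : Module.Basis (Fin n) ℝ (GroupLieAlgebra 𝓘(ℝ, E) N)) : Prop :=
  ∀ i : Fin n, ∀ Z W : GroupLieAlgebra 𝓘(ℝ, E) N,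
    W ∈ Submodule.span ℝ (X '' Set.Iic i) → ⁅Z, W⁆ ∈ Submodule.span ℝ (X '' Set.Iic i)

/-- The strong Malcev basis `X_1, …, X_n` is strongly based on `Γ`:
`Γ = exp(ℤ X_1) ⋯ exp(ℤ X_n)`. -/
structure IsStronglyBasedOn [T2Space N] {n : ℕ}
    (X : Module.Basis (Fin n) ℝ (GroupLieAlgebra 𝓘(ℝ, E) N)) (Γ : Subgroup N) : Prop where
  isStrongMalcevBasis : IsStrongMalcevBasis X
  eq_prod : (Γ : Set N) =
    Set.range fun m : Fin n → ℤ => (List.ofFn fun i => lieExp ((m i : ℝ) • X i)).prod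

variable (E) in
/-- `Λ` is Diophantine with respect to `Γ`. -/
def IsDiophantineWrt [T2Space N] (Λ Γ : Subgroup N) : Prop :=
  ∃ (n : ℕ) (X Y : Module.Basis (Fin n) ℝ (GroupLieAlgebra 𝓘(ℝ, E) N)) (a : Fin n → Fin n → ℝ),
    IsStronglyBasedOn X Γ ∧ IsStronglyBasedOn Y Λ ∧
    (∀ i, Y i = ∑ j ∈ Finset.Iic i, a i j • X j) ∧ ∀ i, IsDiophantine (a i i)

end Lattice

section Cocycle

variable {N : Type*} [Group N]

/-- The space `Γ \ N` of cosets `Γ x`, the orbits of the action of `Γ` by left multiplication. -/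
abbrev CosetSpace (Γ : Subgroup N) : Type _ := MulAction.orbitRel.Quotient Γ N

/-- The projection `x ↦ Γ x`. -/
def proj (Γ : Subgroup N) (x : N) : CosetSpace Γ := Quotient.mk _ x

/-- Right multiplication `Γ x ↦ Γ x g`. -/
def rightMul (Γ : Subgroup N) (x : CosetSpace Γ) (g : N) : CosetSpace Γ :=
  Quotient.map (· * g) (by
    rintro a b ⟨γ, rfl⟩
    exact ⟨γ, by simp [Subgroup.smul_def, mul_assoc]⟩) x

variable (E : Type*) [NormedAddCommGroup E] [NormedSpace ℝ E]
  [TopologicalSpace N] [ChartedSpace E N]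

/-- Smooth real functions on `Γ \ N`. For discrete `Γ` the manifold structure of `Γ \ N` is the one
that makes the covering map `N → Γ \ N` a local diffeomorphism, so that a function is smooth if
and only if its pullback to `N` is smooth. -/
def IsSmooth (Γ : Subgroup N) (f : CosetSpace Γ → ℝ) : Prop :=
  ContMDiff 𝓘(ℝ, E) 𝓘(ℝ, ℝ) ∞ fun x : N => f (proj Γ x)

/-- Smooth real-valued cocycles over the action of `Λ` on `Γ \ N` by right multiplication. As `Λ`
is discrete, smoothness on `(Γ \ N) × Λ` is smoothness in the first variable. -/
structure IsSmoothCocycle (Γ Λ : Subgroup N) (c : CosetSpace Γ → Λ → ℝ) : Prop where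
  smooth : ∀ l : Λ, IsSmooth E Γ fun x => c x l
  map_mul : ∀ (x : CosetSpace Γ) (l l' : Λ), c x (l * l') = c x l + c (rightMul Γ x l) l'

/-- `c` and `c'` are cohomologous: they differ by the coboundary of a smooth function `P`. -/
def Cohomologous (Γ Λ : Subgroup N) (c c' : CosetSpace Γ → Λ → ℝ) : Prop :=
  ∃ P : CosetSpace Γ → ℝ, IsSmooth E Γ P ∧
    ∀ (x : CosetSpace Γ) (l : Λ), c x l = -P x + c' x l + P (rightMul Γ x l)

end Cocycle

end

end DiophantineLattice

/-! The proof removes one direction of a Malcev flag at a time. Let `V` be the span of the first `k`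
vectors, an ideal, and suppose that every `c(·, l)`, pulled back to `N`, is killed by `V`. The
adjoint action of a nilpotent group is unipotent, so the next vector `X` is fixed by it modulo `V`.
Hence on functions killed by `V` the flow of `X` commutes with all translations. It has period 1
because `exp X` lies in `Γ`. Right translation by `y = exp Y`, with `Y = aX` modulo `V`, then
rotates these circle fibres by the Diophantine number `a`.

On the fibres the equation `P(gy) - P(g) = c(g, y) - average` is solved by dividing Fourier
coefficients by `exp(2πima) - 1` (`exists_kernel`, `Adm.exists_coboundary`). To keep `P` smooth on
all of `N`, the solution is written as the integral of a continuous kernel against a high derivative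
of `c(·, y)` along `X`, and smoothness passes under the integral sign (`contMDiff_integral`).

After this correction the cocycle `b` is constant on fibres at `y`. The other elements of `Λ` follow
by descending the lower central series of `Λ`. If `μ` is the commutator with `ly = ylμ` and `b(·,
μ)` is already constant on fibres, the cocycle identity makes `b(gy, l) - b(g, l)` constant on
fibres. Its fibre average is zero, so it vanishes. Then `b(·, l)` has the irrational period `a`
along each fibre and is constant there (`exists_cohomologous_sup`).

Once the flag is exhausted the functions are killed by the whole Lie algebra. They are constants
because `N` is connected, and the cocycle identity makes these constants a homomorphism.

The Lie theory needed is that `Ad` differentiates to the bracket, that it preserves ideals (by a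
Grönwall argument), that it is unipotent, and that `exp A` can be moved through a function killed by
`V`. -/

namespace DiophantineLattice

open Filter Topology Set

set_option linter.unusedSectionVars false

/-! ### Invariant derivatives and the adjoint action -/

section Derivative

variable {E : Type*} [NormedAddCommGroup E] [NormedSpace ℝ E]
  {N : Type*} [TopologicalSpace N] [ChartedSpace E N] [Group N] [LieGroup 𝓘(ℝ, E) ∞ N]
  {F : Type*} [NormedAddCommGroup F] [NormedSpace ℝ F]

/-- The derivative at the identity of a vector-valued function. -/
noncomputable def derivOne (u : N → F) : E →L[ℝ] F :=
  mfderiv 𝓘(ℝ, E) 𝓘(ℝ, F) u 1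

/-- The left-invariant derivative of `f` at `g`, as a linear map on the Lie algebra. -/
noncomputable def lderiv (f : N → F) (g : N) : E →L[ℝ] F :=
  derivOne (fun z : N => f (g * z))

/-- The right-invariant derivative of `f` at `g`, as a linear map on the Lie algebra. -/
noncomputable def rderiv (f : N → F) (g : N) : E →L[ℝ] F :=
  derivOne (fun z : N => f (z * g))

/-- The derivative at the identity of a map that fixes the identity. -/
noncomputable def derivOneMap (u : N → N) : E →L[ℝ] E :=
  mfderiv 𝓘(ℝ, E) 𝓘(ℝ, E) u 1

/-- The adjoint action of `N` on its Lie algebra. -/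
noncomputable def Ad (h : N) : E →L[ℝ] E :=
  derivOneMap (fun z : N => h * z * h⁻¹)

/-- With fixed base points both coordinate changes are identities. Thus smoothness of a derivative
in tangent coordinates, as given by `ContMDiffAt.mfderiv`, is smoothness of a map into one fixed
space of linear maps. -/
theorem inTangentCoordinates_const {M : Type*} [TopologicalSpace M] [ChartedSpace E M]
    [IsManifold 𝓘(ℝ, E) 1 M] {M' : Type*} [TopologicalSpace M'] [ChartedSpace F M']
    [IsManifold 𝓘(ℝ, F) 1 M'] {T : Type*} (p : M) (p' : M') (ϕ : T → E →L[ℝ] F) (x : T) :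
    inTangentCoordinates 𝓘(ℝ, E) 𝓘(ℝ, F) (fun _ => p) (fun _ => p') ϕ x = ϕ := by
  funext y
  rw [inTangentCoordinates_eq _ _ _ (mem_chart_source E p) (mem_chart_source F p')]
  ext v
  simp only [ContinuousLinearMap.comp_apply]
  rw [(tangentBundleCore 𝓘(ℝ, E) M).coordChange_self (achart E p) p (mem_chart_source E p) v,
    (tangentBundleCore 𝓘(ℝ, F) M').coordChange_self (achart F p') p' (mem_chart_source F p')]

theorem inTangentCoordinates_const_model {M : Type*} [TopologicalSpace M] [ChartedSpace E M]
    [IsManifold 𝓘(ℝ, E) 1 M] {T : Type*} (p : M) (q : T → F) (ϕ : T → E →L[ℝ] F) (x : T) :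
    inTangentCoordinates 𝓘(ℝ, E) 𝓘(ℝ, F) (fun _ => p) q ϕ x = ϕ := by
  funext y
  rw [inTangentCoordinates_eq _ _ _ (mem_chart_source E p)
    (by rw [chartAt_self_eq]; exact Set.mem_univ _)]
  ext v
  simp only [ContinuousLinearMap.comp_apply]
  rw [(tangentBundleCore 𝓘(ℝ, E) M).coordChange_self (achart E p) p (mem_chart_source E p) v]
  rw [tangentBundleCore_coordChange_model_space]
  rfl

theorem contMDiffAt_derivOne {M : Type*} [TopologicalSpace M] {H E' : Type*}
    [NormedAddCommGroup E'] [NormedSpace ℝ E'] [TopologicalSpace H] {I : ModelWithCorners ℝ E' H}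
    [ChartedSpace H M] [IsManifold I ∞ M] {u : M → N → F} {x : M}
    (hu : ContMDiffAt (I.prod 𝓘(ℝ, E)) 𝓘(ℝ, F) ∞ (Function.uncurry u) (x, 1)) :
    ContMDiffAt I 𝓘(ℝ, E →L[ℝ] F) ∞ (fun y => derivOne (E := E) (u y)) x := by
  have h : ContMDiffAt I 𝓘(ℝ, E →L[ℝ] F) ∞ (inTangentCoordinates 𝓘(ℝ, E) 𝓘(ℝ, F)
      (fun _ => (1 : N)) (fun y => u y 1) (fun y => derivOne (u y)) x) x :=
    ContMDiffAt.mfderiv (I := 𝓘(ℝ, E)) (m := ∞) u (fun _ => (1 : N)) hu contMDiffAt_const (by simp)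
  rwa [inTangentCoordinates_const_model] at h

theorem contMDiff_Ad : ContMDiff 𝓘(ℝ, E) 𝓘(ℝ, E →L[ℝ] E) ∞ (fun h : N => Ad (E := E) h) := by
  intro x
  have hu : ContMDiffAt (𝓘(ℝ, E).prod 𝓘(ℝ, E)) 𝓘(ℝ, E) ∞
    (Function.uncurry fun h z : N => h * z * h⁻¹) (x, 1) :=
    ((contMDiff_fst.mul contMDiff_snd).mul contMDiff_fst.inv).contMDiffAt
  have h : ContMDiffAt 𝓘(ℝ, E) 𝓘(ℝ, E →L[ℝ] E) ∞ (inTangentCoordinates 𝓘(ℝ, E) 𝓘(ℝ, E)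
      (fun _ => (1 : N)) (fun y : N => y * 1 * y⁻¹) (fun y => Ad y) x) x :=
    ContMDiffAt.mfderiv (I := 𝓘(ℝ, E)) (m := ∞) (fun h z : N => h * z * h⁻¹) (fun _ => (1 : N)) hu
      contMDiffAt_const (by simp)
  have e : (fun y : N => y * 1 * y⁻¹) = fun _ => 1 := by funext y; simp
  rwa [e, inTangentCoordinates_const] at h

theorem lderiv_apply_eq_mulInvariantVectorField {f : N → F} (g : N)
    (hf : MDifferentiableAt 𝓘(ℝ, E) 𝓘(ℝ, F) f g) (W : GroupLieAlgebra 𝓘(ℝ, E) N) :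
    lderiv (E := E) f g W = mfderiv 𝓘(ℝ, E) 𝓘(ℝ, F) f g (mulInvariantVectorField W g) := by
  have hd : MDifferentiableAt 𝓘(ℝ, E) 𝓘(ℝ, E) (fun y : N => g * y) 1 :=
    (contMDiff_mul_left (I := 𝓘(ℝ, E)) (n := ∞) (a := g)).mdifferentiable (by simp) 1
  exact mfderiv_comp_apply_of_eq (I' := 𝓘(ℝ, E)) (x := (1 : N)) (g := f) (f := fun y : N => g * y) hf hd (by simp) W

theorem contMDiffAt_lderiv {f : N → F} {g : N} (hf : ContMDiffAt 𝓘(ℝ, E) 𝓘(ℝ, F) ∞ f g) :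
    ContMDiffAt 𝓘(ℝ, E) 𝓘(ℝ, E →L[ℝ] F) ∞ (lderiv (E := E) f) g := by
  refine contMDiffAt_derivOne (u := fun g z => f (g * z)) ?_
  have h1 : ContMDiffAt (𝓘(ℝ, E).prod 𝓘(ℝ, E)) 𝓘(ℝ, E) ∞ (fun p : N × N => p.1 * p.2) (g, 1) :=
    (contMDiff_fst.mul contMDiff_snd).contMDiffAt
  exact ContMDiffAt.comp (g, 1) (by simpa using hf) h1

theorem lderiv_comp_mul_left (f : N → F) (g h : N) :
    lderiv (E := E) (fun z => f (h * z)) g = lderiv f (h * g) := by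
  simp only [lderiv, mul_assoc]

theorem mdifferentiable_conj (h : N) :
    MDifferentiable 𝓘(ℝ, E) 𝓘(ℝ, E) (fun z : N => h * z * h⁻¹) :=
  ((contMDiff_const.mul contMDiff_id).mul contMDiff_const : ContMDiff 𝓘(ℝ, E) 𝓘(ℝ, E) ∞
    (fun z : N => h * z * h⁻¹)).mdifferentiable (by simp)

theorem derivOne_comp_conj {u : N → F} (hu : MDifferentiableAt 𝓘(ℝ, E) 𝓘(ℝ, F) u 1) (h : N) :
    derivOne (fun z => u (h * z * h⁻¹)) = (derivOne u).comp (Ad (E := E) h) := by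
  ext W
  have := mfderiv_comp_apply_of_eq (I := 𝓘(ℝ, E)) (I' := 𝓘(ℝ, E)) (I'' := 𝓘(ℝ, F)) (x := (1 : N)) (g := u) (f := fun y : N => h * y * h⁻¹) (y := 1) hu
    (mdifferentiable_conj h 1) (by simp) W
  exact this

theorem Ad_mul (g h : N) : Ad (E := E) (g * h) = (Ad g).comp (Ad h) := by
  ext W
  have := mfderiv_comp_apply_of_eq (I := 𝓘(ℝ, E)) (I' := 𝓘(ℝ, E)) (I'' := 𝓘(ℝ, E)) (x := (1 : N))
    (g := fun y : N => g * y * g⁻¹) (f := fun y : N => h * y * h⁻¹) (y := 1)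
    (mdifferentiable_conj g 1) (mdifferentiable_conj h 1) (by simp) W
  have e : (fun y : N => g * h * y * (g * h)⁻¹) =
    (fun y : N => g * y * g⁻¹) ∘ (fun y : N => h * y * h⁻¹) := by
    funext y; simp [mul_assoc]
  exact (congrArg (fun u => derivOneMap u W) e).trans this

theorem Ad_one : Ad (E := E) (1 : N) = ContinuousLinearMap.id ℝ E := by
  have e : (fun y : N => 1 * y * 1⁻¹) = id := by
    funext y; simp
  unfold Ad
  rw [e]
  exact mfderiv_id

/-- This rewrites `gzh` as `gh(h⁻¹zh)`. The twist by `Ad h⁻¹` is harmless for vanishing along an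
`Ad`-invariant subspace. -/
theorem lderiv_comp_mul_right {f : N → F} {g h : N}
    (hf : MDifferentiableAt 𝓘(ℝ, E) 𝓘(ℝ, F) f (g * h)) :
    lderiv (E := E) (fun z => f (z * h)) g = (lderiv f (g * h)).comp (Ad h⁻¹) := by
  unfold lderiv
  rw [← derivOne_comp_conj]
  · simp [mul_assoc]
  · refine MDifferentiableAt.comp (I' := 𝓘(ℝ, E)) (1 : N) (by simpa using hf) ?_
    exact (contMDiff_mul_left (I := 𝓘(ℝ, E)) (n := ∞)).mdifferentiable (by simp) 1

theorem lderiv_eq_rderiv_comp_Ad {f : N → F} {h : N}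
    (hf : MDifferentiableAt 𝓘(ℝ, E) 𝓘(ℝ, F) f h) :
    lderiv (E := E) f h = (rderiv f h).comp (Ad h) := by
  unfold lderiv rderiv
  rw [← derivOne_comp_conj]
  · simp [mul_assoc]
  · refine MDifferentiableAt.comp (I' := 𝓘(ℝ, E)) (1 : N) (by simpa using hf) ?_
    exact (contMDiff_mul_right (I := 𝓘(ℝ, E)) (n := ∞)).mdifferentiable (by simp) 1

end Derivative

/-! ### The bracket as a commutator of derivations -/

section Bracket

variable {E : Type*} [NormedAddCommGroup E] [NormedSpace ℝ E]
  {N : Type*} [TopologicalSpace N] [ChartedSpace E N] [Group N] [LieGroup 𝓘(ℝ, E) ∞ N]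
  {F : Type*} [NormedAddCommGroup F] [NormedSpace ℝ F]

theorem derivOne_eq_fderiv {u : N → F} (hu : MDifferentiableAt 𝓘(ℝ, E) 𝓘(ℝ, F) u 1) :
    derivOne (E := E) u = fderiv ℝ (u ∘ (extChartAt 𝓘(ℝ, E) (1 : N)).symm)
      (extChartAt 𝓘(ℝ, E) (1 : N) 1) := by
  have h : HasFDerivWithinAt (u ∘ (extChartAt 𝓘(ℝ, E) (1 : N)).symm) (derivOne (E := E) u)
    (range 𝓘(ℝ, E)) (extChartAt 𝓘(ℝ, E) (1 : N) 1) := hu.hasMFDerivAt.2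
  rw [ModelWithCorners.range_eq_univ, hasFDerivWithinAt_univ] at h
  exact h.fderiv.symm

theorem derivOne_extChartAt :
    derivOne (E := E) (extChartAt 𝓘(ℝ, E) (1 : N)) = ContinuousLinearMap.id ℝ E := by
  have : IsManifold 𝓘(ℝ, E) 1 N := .of_le (n := ∞) (by simp)
  rw [derivOne_eq_fderiv (mdifferentiableAt_extChartAt (by simp))]
  have e : (extChartAt 𝓘(ℝ, E) (1 : N)) ∘ (extChartAt 𝓘(ℝ, E) (1 : N)).symm
      =ᶠ[𝓝 (extChartAt 𝓘(ℝ, E) (1 : N) 1)] id := by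
    filter_upwards [extChartAt_target_mem_nhds (I := 𝓘(ℝ, E)) (1 : N)] with x hx
    exact (extChartAt 𝓘(ℝ, E) (1 : N)).right_inv hx
  rw [e.fderiv_eq, fderiv_id]

/-- The dictionary between the group and the chart at the identity: a left-invariant derivative
becomes a derivative along the pulled-back vector field, so brackets can be computed in a vector
space. -/
theorem fderiv_chart_mpullback {f : N → F} {x : E}
    (hx : x ∈ (extChartAt 𝓘(ℝ, E) (1 : N)).target)
    (hf : MDifferentiableAt 𝓘(ℝ, E) 𝓘(ℝ, F) f ((extChartAt 𝓘(ℝ, E) (1 : N)).symm x))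
    (W : GroupLieAlgebra 𝓘(ℝ, E) N) :
    fderiv ℝ (f ∘ (extChartAt 𝓘(ℝ, E) (1 : N)).symm) x
      (VectorField.mpullbackWithin 𝓘(ℝ, E) 𝓘(ℝ, E) (extChartAt 𝓘(ℝ, E) (1 : N)).symm
        (mulInvariantVectorField W) (range 𝓘(ℝ, E)) x) =
      lderiv (E := E) f ((extChartAt 𝓘(ℝ, E) (1 : N)).symm x) W := by
  have : IsManifold 𝓘(ℝ, E) 1 N := .of_le (n := ∞) (by simp)
  rw [lderiv_apply_eq_mulInvariantVectorField _ hf, VectorField.mpullbackWithin_apply]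
  have hs : MDifferentiableAt 𝓘(ℝ, E) 𝓘(ℝ, E) (extChartAt 𝓘(ℝ, E) (1 : N)).symm x := by
    have := mdifferentiableWithinAt_extChartAt_symm (I := 𝓘(ℝ, E)) hx
    simpa [mdifferentiableWithinAt_univ] using this
  have hi := isInvertible_mfderivWithin_extChartAt_symm (I := 𝓘(ℝ, E)) hx
  have h1 := mfderiv_comp_apply (I := 𝓘(ℝ, E)) (I' := 𝓘(ℝ, E)) (I'' := 𝓘(ℝ, F)) x hf hs
    ((mfderivWithin 𝓘(ℝ, E) 𝓘(ℝ, E) (extChartAt 𝓘(ℝ, E) (1 : N)).symm (range 𝓘(ℝ, E)) x).inverse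
      (mulInvariantVectorField W ((extChartAt 𝓘(ℝ, E) (1 : N)).symm x)))
  rw [mfderiv_eq_fderiv] at h1
  refine h1.trans ?_
  have e : mfderiv 𝓘(ℝ, E) 𝓘(ℝ, E) (extChartAt 𝓘(ℝ, E) (1 : N)).symm x =
    mfderivWithin 𝓘(ℝ, E) 𝓘(ℝ, E) (extChartAt 𝓘(ℝ, E) (1 : N)).symm (range 𝓘(ℝ, E)) x := by
    rw [ModelWithCorners.range_eq_univ, mfderivWithin_univ]
  rw [e, hi.self_apply_inverse]

/-- The Lie bracket of the Lie algebra, on the model space. -/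
noncomputable def lieModel (N : Type*) [TopologicalSpace N] [ChartedSpace E N] [Group N]
    (Z W : E) : E :=
  VectorField.mlieBracket 𝓘(ℝ, E) (mulInvariantVectorField (I := 𝓘(ℝ, E)) (G := N) Z)
    (mulInvariantVectorField (I := 𝓘(ℝ, E)) (G := N) W) 1

theorem mpullback_chart_one (U : E) :
    VectorField.mpullbackWithin 𝓘(ℝ, E) 𝓘(ℝ, E) (extChartAt 𝓘(ℝ, E) (1 : N)).symm
      (mulInvariantVectorField (G := N) U) (range 𝓘(ℝ, E)) (extChartAt 𝓘(ℝ, E) (1 : N) 1) = U := by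
  have : IsManifold 𝓘(ℝ, E) 1 N := .of_le (n := ∞) (by simp)
  have h := fderiv_chart_mpullback (N := N) (f := extChartAt 𝓘(ℝ, E) (1 : N))
    (mem_extChartAt_target (I := 𝓘(ℝ, E)) (1 : N))
    (by rw [extChartAt_to_inv]; exact mdifferentiableAt_extChartAt (by simp)) U
  rw [← derivOne_eq_fderiv (mdifferentiableAt_extChartAt (by simp)), extChartAt_to_inv] at h
  simp only [lderiv, one_mul, derivOne_extChartAt] at h
  exact h

/-- The formula `[Z, W]f = Z(Wf) - W(Zf)` at the identity, transported from the vector space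
bracket. There the second derivatives of `f` cancel by symmetry. -/
theorem derivOne_lie [CompleteSpace E] {f : N → F} (hf : ContMDiffAt 𝓘(ℝ, E) 𝓘(ℝ, F) ∞ f 1)
    (Z W : E) : derivOne f (lieModel N Z W) =
      derivOne (E := E) (fun h => lderiv (E := E) f h W) Z -
        derivOne (E := E) (fun h => lderiv (E := E) f h Z) W := by
  have : IsManifold 𝓘(ℝ, E) 1 N := .of_le (n := ∞) (by simp)
  have : IsManifold 𝓘(ℝ, E) 2 N := .of_le (n := ∞) (by norm_cast)
  set φ := extChartAt 𝓘(ℝ, E) (1 : N) with hφ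
  let V : E → E → E := fun U => VectorField.mpullbackWithin 𝓘(ℝ, E) 𝓘(ℝ, E)
        φ.symm (mulInvariantVectorField (G := N) U) (range 𝓘(ℝ, E))
  have hd : ∀ U : E, DifferentiableAt ℝ (V U) (φ 1) := by
    intro U
    have h := ((contMDiff_invariantField (E := E) (N := N) U).mdifferentiable
      one_ne_zero 1).mdifferentiableWithinAt (s := univ)
    have := MDifferentiableWithinAt.differentiableWithinAt_mpullbackWithin_vectorField h
    rw [preimage_univ, univ_inter] at this
    exact this.differentiableAt (by rw [ModelWithCorners.range_eq_univ]; exact univ_mem)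
  have hφ1 : φ.symm (φ 1) = 1 := extChartAt_to_inv 1
  have hsm : ∀ {u : N → F}, ContMDiffAt 𝓘(ℝ, E) 𝓘(ℝ, F) ∞ u 1 → ContDiffAt ℝ 2 (u ∘ φ.symm) (φ 1) := by
    intro u hu
    have h1 : ContMDiffAt 𝓘(ℝ, E) 𝓘(ℝ, E) ∞ φ.symm (φ 1) :=
      contMDiffOn_extChartAt_symm (I := 𝓘(ℝ, E)) (n := ∞) (1 : N) |>.contMDiffAt
        (extChartAt_target_mem_nhds (I := 𝓘(ℝ, E)) (1 : N))
    have h2 := ContMDiffAt.comp (φ 1) (g := u) (by rwa [hφ1]) h1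
    exact h2.contDiffAt.of_le (by norm_cast)
  have hf1 : MDifferentiableAt 𝓘(ℝ, E) 𝓘(ℝ, F) f 1 := hf.mdifferentiableAt (by simp)
  have hW : ∀ U : E, derivOne (E := E) (fun h => lderiv (E := E) f h U) =
      fderiv ℝ (fun x => fderiv ℝ (f ∘ φ.symm) x (V U x)) (φ 1) := by
    intro U
    rw [derivOne_eq_fderiv]
    · refine Filter.EventuallyEq.fderiv_eq ?_
      have hev : ∀ᶠ g in 𝓝 (1 : N), MDifferentiableAt 𝓘(ℝ, E) 𝓘(ℝ, F) f g := by
        have h1 : ContMDiffAt 𝓘(ℝ, E) 𝓘(ℝ, F) 1 f 1 := hf.of_le (by norm_cast)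
        have := (contMDiffAt_iff_contMDiffAt_nhds (by simp)).1 h1
        exact this.mono fun g hg => hg.mdifferentiableAt (by simp)
      have hc : Tendsto φ.symm (𝓝 (φ 1)) (𝓝 1) := by
        have := continuousAt_extChartAt_symm (I := 𝓘(ℝ, E)) (1 : N)
        rwa [ContinuousAt, extChartAt_to_inv] at this
      filter_upwards [extChartAt_target_mem_nhds (I := 𝓘(ℝ, E)) (1 : N), hc.eventually hev]
        with x hx hx'
      exact (fderiv_chart_mpullback hx hx' U).symm
    · have := (contMDiffAt_lderiv hf).mdifferentiableAt (by simp)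
      exact this.clm_apply mdifferentiableAt_const
  have hV : ∀ U : E, V U (φ 1) = U := mpullback_chart_one
  have h2 := VectorField.fderiv_apply_lieBracket (hsm hf) (by simp) (hd W) (hd Z)
  rw [hV, hV] at h2
  rw [hW, hW, derivOne_eq_fderiv hf1, ← h2]
  congr 1
  have h3 : lieModel N Z W = (derivOne (E := E) φ).inverse (VectorField.lieBracketWithin ℝ (V Z) (V W)
      (φ.symm ⁻¹' univ ∩ range 𝓘(ℝ, E)) (φ 1)) :=
    VectorField.mlieBracketWithin_apply (I := 𝓘(ℝ, E))
      (V := mulInvariantVectorField (G := N) Z)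
      (W := mulInvariantVectorField (G := N) W) (s := univ) (x₀ := 1)
  rw [h3, derivOne_extChartAt, preimage_univ, univ_inter, ModelWithCorners.range_eq_univ,
    VectorField.lieBracketWithin_univ, ContinuousLinearMap.inverse_id]
  rfl

end Bracket

/-! ### The derivative of the adjoint representation -/

section AdDerivative

theorem fderiv_fderiv_partial {E F : Type*} [NormedAddCommGroup E] [NormedSpace ℝ E]
    [NormedAddCommGroup F] [NormedSpace ℝ F] {ψ : E × E → F} {x y : E}
    (h : ContDiffAt ℝ 2 ψ (x, y)) (Z W : E) :
    fderiv ℝ (fun b => fderiv ℝ (fun a => ψ (a, b)) x W) y Z =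
      fderiv ℝ (fun a => fderiv ℝ (fun b => ψ (a, b)) y Z) x W := by
  have hs : IsSymmSndFDerivAt ℝ ψ (x, y) := h.isSymmSndFDerivAt (by simp)
  have hd : ∀ᶠ p in 𝓝 (x, y), DifferentiableAt ℝ ψ p :=
    (h.eventually (by simp)).mono fun p hp => hp.differentiableAt (by simp)
  have hdd : DifferentiableAt ℝ (fderiv ℝ ψ) (x, y) :=
    (h.fderiv_right (m := 1) (by norm_num)).differentiableAt (by simp)
  have hl : ∀ {a b : E}, HasFDerivAt (fun a : E => (a, b)) (ContinuousLinearMap.inl ℝ E E) a :=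
    fun {a b} => hasFDerivAt_prodMk_left a b
  have hr : ∀ {a b : E}, HasFDerivAt (fun b : E => (a, b)) (ContinuousLinearMap.inr ℝ E E) b :=
    fun {a b} => hasFDerivAt_prodMk_right a b
  have e1 : (fun b => fderiv ℝ (fun a => ψ (a, b)) x W) =ᶠ[𝓝 y] fun b => fderiv ℝ ψ (x, b) (W, 0) := by
    filter_upwards [(hr (a := x) (b := y)).continuousAt.eventually hd] with b hb
    rw [show (fun a => ψ (a, b)) = ψ ∘ fun a => (a, b) from rfl, (hb.hasFDerivAt.comp x hl).fderiv]
    simp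
  have e2 : (fun a => fderiv ℝ (fun b => ψ (a, b)) y Z) =ᶠ[𝓝 x] fun a => fderiv ℝ ψ (a, y) (0, Z) := by
    filter_upwards [(hl (a := x) (b := y)).continuousAt.eventually hd] with a ha
    rw [show (fun b => ψ (a, b)) = ψ ∘ fun b => (a, b) from rfl, (ha.hasFDerivAt.comp y hr).fderiv]
    simp
  rw [e1.fderiv_eq, e2.fderiv_eq]
  have d1 := (hdd.hasFDerivAt.comp y (hr (a := x))).clm_apply (hasFDerivAt_const (W, (0 : E)) y)
  have d2 := (hdd.hasFDerivAt.comp x (hl (b := y))).clm_apply (hasFDerivAt_const ((0 : E), Z) x)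
  have d1' := d1.fderiv
  have d2' := d2.fderiv
  simp only [Function.comp_def] at d1' d2'
  rw [d1', d2']
  simpa using hs (0, Z) (W, 0)

variable {E : Type*} [NormedAddCommGroup E] [NormedSpace ℝ E]
  {N : Type*} [TopologicalSpace N] [ChartedSpace E N] [Group N] [LieGroup 𝓘(ℝ, E) ∞ N]
  {F : Type*} [NormedAddCommGroup F] [NormedSpace ℝ F]

theorem contMDiffAt_chart_symm :
    ContMDiffAt 𝓘(ℝ, E) 𝓘(ℝ, E) ∞ (extChartAt 𝓘(ℝ, E) (1 : N)).symm
      (extChartAt 𝓘(ℝ, E) (1 : N) 1) :=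
  contMDiffOn_extChartAt_symm (I := 𝓘(ℝ, E)) (n := ∞) (1 : N) |>.contMDiffAt
    (extChartAt_target_mem_nhds (I := 𝓘(ℝ, E)) (1 : N))

theorem tendsto_chart_symm :
    Tendsto (extChartAt 𝓘(ℝ, E) (1 : N)).symm (𝓝 (extChartAt 𝓘(ℝ, E) (1 : N) 1)) (𝓝 1) := by
  have := continuousAt_extChartAt_symm (I := 𝓘(ℝ, E)) (1 : N)
  rwa [ContinuousAt, extChartAt_to_inv] at this

theorem eventually_mdifferentiableAt {f : N → F} {g : N}
    (hf : ContMDiffAt 𝓘(ℝ, E) 𝓘(ℝ, F) ∞ f g) :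
    ∀ᶠ h in 𝓝 g, MDifferentiableAt 𝓘(ℝ, E) 𝓘(ℝ, F) f h := by
  have : IsManifold 𝓘(ℝ, E) 1 N := .of_le (n := ∞) (by simp)
  have h1 : ContMDiffAt 𝓘(ℝ, E) 𝓘(ℝ, F) 1 f g := hf.of_le (by norm_cast)
  exact ((contMDiffAt_iff_contMDiffAt_nhds (by simp)).1 h1).mono fun g hg =>
    hg.mdifferentiableAt (by simp)

theorem derivOne_congr {u v : N → F} (h : u =ᶠ[𝓝 1] v) : derivOne (E := E) u = derivOne v :=
  h.mfderiv_eq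

theorem contMDiffAt_rderiv {f : N → F} {g : N} (hf : ContMDiffAt 𝓘(ℝ, E) 𝓘(ℝ, F) ∞ f g) :
    ContMDiffAt 𝓘(ℝ, E) 𝓘(ℝ, E →L[ℝ] F) ∞ (rderiv (E := E) f) g := by
  refine contMDiffAt_derivOne (u := fun g z => f (z * g)) ?_
  have h1 : ContMDiffAt (𝓘(ℝ, E).prod 𝓘(ℝ, E)) 𝓘(ℝ, E) ∞ (fun p : N × N => p.2 * p.1) (g, 1) :=
    (contMDiff_snd.mul contMDiff_fst).contMDiffAt
  exact ContMDiffAt.comp (g, 1) (by simpa using hf) h1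

theorem mdifferentiableAt_comp_mul_left {f : N → F} {g : N}
    (hf : MDifferentiableAt 𝓘(ℝ, E) 𝓘(ℝ, F) f g) :
    MDifferentiableAt 𝓘(ℝ, E) 𝓘(ℝ, F) (fun z => f (g * z)) 1 := by
  refine MDifferentiableAt.comp (I' := 𝓘(ℝ, E)) (1 : N) (by simpa using hf) ?_
  exact (contMDiff_mul_left (I := 𝓘(ℝ, E)) (n := ∞)).mdifferentiable (by simp) 1

theorem mdifferentiableAt_comp_mul_right {f : N → F} {g : N}
    (hf : MDifferentiableAt 𝓘(ℝ, E) 𝓘(ℝ, F) f g) :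
    MDifferentiableAt 𝓘(ℝ, E) 𝓘(ℝ, F) (fun z => f (z * g)) 1 := by
  refine MDifferentiableAt.comp (I' := 𝓘(ℝ, E)) (1 : N) (by simpa using hf) ?_
  exact (contMDiff_mul_right (I := 𝓘(ℝ, E)) (n := ∞)).mdifferentiable (by simp) 1

/-- Both sides are the mixed second derivative of `(a, b) ↦ f(ab)` at `(1, 1)`, with `W` in the
first variable and `Z` in the second. -/
theorem derivOne_rderiv_comm {f : N → F} (hf : ContMDiffAt 𝓘(ℝ, E) 𝓘(ℝ, F) ∞ f 1) (Z W : E) :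
    derivOne (E := E) (fun h => rderiv (E := E) f h W) Z =
      derivOne (E := E) (fun h => lderiv (E := E) f h Z) W := by
  rw [derivOne_eq_fderiv (((contMDiffAt_rderiv hf).mdifferentiableAt (by simp)).clm_apply
      mdifferentiableAt_const),
    derivOne_eq_fderiv (((contMDiffAt_lderiv hf).mdifferentiableAt (by simp)).clm_apply
      mdifferentiableAt_const)]
  set φ := extChartAt 𝓘(ℝ, E) (1 : N) with hφ
  have hφ1 : φ.symm (φ 1) = 1 := extChartAt_to_inv 1
  have hψ : ContDiffAt ℝ 2 (fun p : E × E => f (φ.symm p.1 * φ.symm p.2)) (φ 1, φ 1) := by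
    have h1 : ContMDiffAt 𝓘(ℝ, E × E) 𝓘(ℝ, E) ∞ (fun p : E × E => φ.symm p.1 * φ.symm p.2)
        (φ 1, φ 1) := by
      refine ContMDiffAt.mul ?_ ?_
      · exact ContMDiffAt.comp (φ 1, φ 1) (g := φ.symm) contMDiffAt_chart_symm
          contDiffAt_fst.contMDiffAt
      · exact ContMDiffAt.comp (φ 1, φ 1) (g := φ.symm) contMDiffAt_chart_symm
          contDiffAt_snd.contMDiffAt
    have h2 := ContMDiffAt.comp (φ 1, φ 1) (g := f) (by simpa [hφ1] using hf) h1
    exact h2.contDiffAt.of_le (by norm_cast)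
  have h := fderiv_fderiv_partial hψ Z W
  have ev := tendsto_chart_symm (E := E) (N := N) |>.eventually (eventually_mdifferentiableAt hf)
  have e1 : (fun h => rderiv (E := E) f h W) ∘ φ.symm =ᶠ[𝓝 (φ 1)]
      fun b => fderiv ℝ (fun a => f (φ.symm a * φ.symm b)) (φ 1) W := by
    filter_upwards [ev] with b hb
    simp only [rderiv, Function.comp_apply]
    rw [derivOne_eq_fderiv (mdifferentiableAt_comp_mul_right hb)]
    rfl
  have e2 : (fun h => lderiv (E := E) f h Z) ∘ φ.symm =ᶠ[𝓝 (φ 1)]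
      fun a => fderiv ℝ (fun b => f (φ.symm a * φ.symm b)) (φ 1) Z := by
    filter_upwards [ev] with b hb
    simp only [lderiv, Function.comp_apply]
    rw [derivOne_eq_fderiv (mdifferentiableAt_comp_mul_left hb)]
    rfl
  rw [e1.fderiv_eq, e2.fderiv_eq]
  exact h

theorem differentiableAt_comp_chart_symm {u : N → F}
    (hu : MDifferentiableAt 𝓘(ℝ, E) 𝓘(ℝ, F) u 1) :
    DifferentiableAt ℝ (u ∘ (extChartAt 𝓘(ℝ, E) (1 : N)).symm) (extChartAt 𝓘(ℝ, E) (1 : N) 1) := by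
  have h := hu.hasMFDerivAt.2
  rw [ModelWithCorners.range_eq_univ] at h
  exact (h : HasFDerivWithinAt (u ∘ (extChartAt 𝓘(ℝ, E) (1 : N)).symm) (derivOne (E := E) u)
    univ (extChartAt 𝓘(ℝ, E) (1 : N) 1)).hasFDerivAt univ_mem |>.differentiableAt

theorem derivOne_clm_apply {G : Type*} [NormedAddCommGroup G] [NormedSpace ℝ G]
    {A : N → F →L[ℝ] G} {u : N → F}
    (hA : MDifferentiableAt 𝓘(ℝ, E) 𝓘(ℝ, F →L[ℝ] G) A 1)
    (hu : MDifferentiableAt 𝓘(ℝ, E) 𝓘(ℝ, F) u 1) (Z : E) :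
    derivOne (E := E) (fun h => A h (u h)) Z = derivOne (E := E) A Z (u 1) +
      A 1 (derivOne (E := E) u Z) := by
  rw [derivOne_eq_fderiv (hA.clm_apply hu), derivOne_eq_fderiv hA, derivOne_eq_fderiv hu]
  have h := ((differentiableAt_comp_chart_symm hA).hasFDerivAt.clm_apply
    (differentiableAt_comp_chart_symm hu).hasFDerivAt).fderiv
  have e : (fun h => (A h) (u h)) ∘ (extChartAt 𝓘(ℝ, E) (1 : N)).symm = fun x =>
    (A ∘ (extChartAt 𝓘(ℝ, E) (1 : N)).symm) x ((u ∘ (extChartAt 𝓘(ℝ, E) (1 : N)).symm) x) := rfl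
  rw [e, h]
  simp [add_comm]

/-- The derivative of the adjoint representation at the identity is the Lie bracket. -/
theorem derivOne_Ad [CompleteSpace E] (Z W : E) :
    derivOne (E := E) (fun h : N => Ad (E := E) h) Z W = lieModel N Z W := by
  set φ := extChartAt 𝓘(ℝ, E) (1 : N) with hφ
  have hf : ContMDiffAt 𝓘(ℝ, E) 𝓘(ℝ, E) ∞ φ 1 := contMDiffAt_extChartAt
  have hA : MDifferentiableAt 𝓘(ℝ, E) 𝓘(ℝ, E →L[ℝ] E) (fun h : N => Ad (E := E) h) 1 :=
    contMDiff_Ad.mdifferentiable (by simp) 1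
  have h := derivOne_lie hf Z W
  -- Differentiating the right side along `Z` by the product rule gives a derivative of `rderiv`,
  -- which cancels the second term of `derivOne_lie`, and the derivative of `Ad`, which survives.
  -- The chart serves as test function because its derivative at the identity is the identity map.
  have e : (fun h => lderiv (E := E) φ h W) =ᶠ[𝓝 1] fun h => rderiv (E := E) φ h (Ad h W) := by
    filter_upwards [eventually_mdifferentiableAt hf] with h hh
    rw [lderiv_eq_rderiv_comp_Ad hh]; rfl
  have hr1 : rderiv (E := E) φ (1 : N) = ContinuousLinearMap.id ℝ E := by
    simp only [rderiv, mul_one]; exact derivOne_extChartAt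
  have hr := (contMDiffAt_rderiv hf).mdifferentiableAt (by simp)
  rw [derivOne_congr e, derivOne_clm_apply hr (hA.clm_apply mdifferentiableAt_const),
    derivOne_clm_apply hA mdifferentiableAt_const, ← derivOne_rderiv_comm hf,
    derivOne_clm_apply hr mdifferentiableAt_const, Ad_one, hr1, derivOne_extChartAt] at h
  have h0 : derivOne (E := E) (fun _ : N => W) = 0 := by
    unfold derivOne; exact mfderiv_const
  simp [h0] at h
  exact h.symm

end AdDerivative

/-! ### Uniqueness for invariant linear equations; ideals and unipotence -/

section Gronwall

variable {E : Type*} [NormedAddCommGroup E] [NormedSpace ℝ E]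
  {N : Type*} [TopologicalSpace N] [ChartedSpace E N] [Group N] [LieGroup 𝓘(ℝ, E) ∞ N]
  {F : Type*} [NormedAddCommGroup F] [NormedSpace ℝ F]

/-- The left Maurer-Cartan form in the chart at the identity. -/
noncomputable def chartForm (N : Type*) [TopologicalSpace N] [ChartedSpace E N] [Group N] (x : E) :
    E →L[ℝ] E :=
  fderiv ℝ (fun y => extChartAt 𝓘(ℝ, E) (1 : N)
    (((extChartAt 𝓘(ℝ, E) (1 : N)).symm x)⁻¹ * (extChartAt 𝓘(ℝ, E) (1 : N)).symm y)) x

theorem contDiffAt_chartForm :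
    ContDiffAt ℝ ∞ (chartForm (E := E) N) (extChartAt 𝓘(ℝ, E) (1 : N) 1) := by
  set φ := extChartAt 𝓘(ℝ, E) (1 : N) with hφ
  have hφ1 : φ.symm (φ 1) = 1 := extChartAt_to_inv 1
  have h1 : ContMDiffAt 𝓘(ℝ, E × E) 𝓘(ℝ, E) ∞ (fun p : E × E => (φ.symm p.1)⁻¹ * φ.symm p.2)
      (φ 1, φ 1) := by
    refine ContMDiffAt.mul (ContMDiffAt.inv ?_) ?_
    · exact ContMDiffAt.comp (φ 1, φ 1) (g := φ.symm) contMDiffAt_chart_symm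
        contDiffAt_fst.contMDiffAt
    · exact ContMDiffAt.comp (φ 1, φ 1) (g := φ.symm) contMDiffAt_chart_symm
        contDiffAt_snd.contMDiffAt
  have hf : ContMDiffAt 𝓘(ℝ, E) 𝓘(ℝ, E) ∞ φ 1 := contMDiffAt_extChartAt
  have h2 := ContMDiffAt.comp (φ 1, φ 1) (g := φ) (by simpa [hφ1] using hf) h1
  exact ContDiffAt.fderiv (f := fun x y => φ ((φ.symm x)⁻¹ * φ.symm y)) (g := id) (m := ∞)
    h2.contDiffAt contDiffAt_id (by simp)

/-- With `h` the point of coordinate `x`, write `b` as `z ↦ b(hz)` after `h⁻¹·`; the chain rule in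
the chart separates the invariant derivative from the Maurer-Cartan form. -/
theorem fderiv_comp_chart_symm {b : N → F} (hb : ContMDiff 𝓘(ℝ, E) 𝓘(ℝ, F) ∞ b) {x : E}
    (hx : x ∈ (extChartAt 𝓘(ℝ, E) (1 : N)).target) :
    HasFDerivAt (b ∘ (extChartAt 𝓘(ℝ, E) (1 : N)).symm)
      ((lderiv b ((extChartAt 𝓘(ℝ, E) (1 : N)).symm x)).comp (chartForm N x)) x := by
  set φ := extChartAt 𝓘(ℝ, E) (1 : N) with hφ
  set h := φ.symm x with hh
  have hφ1 : φ.symm (φ 1) = 1 := extChartAt_to_inv 1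
  have hs : ContMDiffAt 𝓘(ℝ, E) 𝓘(ℝ, E) ∞ φ.symm x :=
    contMDiffOn_extChartAt_symm (I := 𝓘(ℝ, E)) (n := ∞) (1 : N) |>.contMDiffAt
      ((isOpen_extChartAt_target (I := 𝓘(ℝ, E)) (1 : N)).mem_nhds hx)
  have hk : ContMDiffAt 𝓘(ℝ, E) 𝓘(ℝ, E) ∞ (fun y => h⁻¹ * φ.symm y) x := contMDiffAt_const.mul hs
  have hf : ContMDiffAt 𝓘(ℝ, E) 𝓘(ℝ, E) ∞ φ 1 := contMDiffAt_extChartAt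
  have hκ : DifferentiableAt ℝ (fun y => φ (h⁻¹ * φ.symm y)) x := by
    have := ContMDiffAt.comp x (g := φ) (by simpa [← hh] using hf) hk
    exact this.contDiffAt.differentiableAt (by simp)
  have hu : MDifferentiableAt 𝓘(ℝ, E) 𝓘(ℝ, F) (fun z => b (h * z)) 1 :=
    mdifferentiableAt_comp_mul_left (hb.mdifferentiable (by simp) h)
  have h1 := (differentiableAt_comp_chart_symm hu).hasFDerivAt
  rw [← derivOne_eq_fderiv hu] at h1
  have hκx : φ (h⁻¹ * φ.symm x) = φ 1 := by simp [← hh]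
  have h2 : HasFDerivAt (((fun z => b (h * z)) ∘ φ.symm) ∘ fun y => φ (h⁻¹ * φ.symm y))
      ((lderiv b h).comp (chartForm N x)) x :=
    HasFDerivAt.comp x (by rw [hκx]; exact h1) hκ.hasFDerivAt
  refine h2.congr_of_eventuallyEq ?_
  have hc : Tendsto (fun y => h⁻¹ * φ.symm y) (𝓝 x) (𝓝 1) := by
    have := hk.continuousAt.tendsto
    simpa [← hh] using this
  filter_upwards [hc.eventually (extChartAt_source_mem_nhds (I := 𝓘(ℝ, E)) (1 : N))] with y hy
  simp only [Function.comp_apply]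
  rw [φ.left_inv hy]; simp

/-- Grönwall's inequality along the segments issuing from the identity in the chart, where the
Maurer-Cartan form is bounded. -/
theorem eventually_eq_zero_of_lderiv_bound {b : N → F} (hb : ContMDiff 𝓘(ℝ, E) 𝓘(ℝ, F) ∞ b) {C : ℝ}
    (hC : ∀ g, ‖lderiv (E := E) b g‖ ≤ C * ‖b g‖) (h1 : b 1 = 0) : ∀ᶠ g in 𝓝 (1 : N), b g = 0 := by
  set φ := extChartAt 𝓘(ℝ, E) (1 : N) with hφ
  set M := ‖chartForm (E := E) N (φ 1)‖ + 1 with hM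
  have e1 : ∀ᶠ x in 𝓝 (φ 1), ‖chartForm (E := E) N x‖ < M :=
    contDiffAt_chartForm.continuousAt.norm.eventually (gt_mem_nhds (by simp [hM, hφ]))
  obtain ⟨r, hr, hball⟩ := Metric.eventually_nhds_iff_ball.1
    (e1.and (extChartAt_target_mem_nhds (I := 𝓘(ℝ, E)) (1 : N)))
  have key : ∀ x ∈ Metric.ball (φ 1) r, b (φ.symm x) = 0 := by
    intro x hx
    have hmem : ∀ t ∈ Icc (0 : ℝ) 1, φ 1 + t • (x - φ 1) ∈ Metric.ball (φ 1) r := fun t ht =>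
      (convex_ball (φ 1) r).add_smul_sub_mem (Metric.mem_ball_self hr) hx ht
    have hd : ∀ t ∈ Icc (0 : ℝ) 1, HasDerivAt (fun t : ℝ => b (φ.symm (φ 1 + t • (x - φ 1))))
        (lderiv (E := E) b (φ.symm (φ 1 + t • (x - φ 1)))
          (chartForm N (φ 1 + t • (x - φ 1)) (x - φ 1))) t := by
      intro t ht
      have h2 := fderiv_comp_chart_symm hb (hball _ (hmem t ht)).2
      have h3 : HasDerivAt (fun t : ℝ => φ 1 + t • (x - φ 1)) (x - φ 1) t := by
        simpa using ((hasDerivAt_id t).smul_const (x - φ 1)).const_add (φ 1)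
      exact h2.comp_hasDerivAt t h3
    have := eq_zero_of_abs_deriv_le_mul_abs_self_of_eq_zero_right (a := 0) (b := 1)
      (K := C * (M * ‖x - φ 1‖)) (fun t ht => (hd t ht).continuousAt.continuousWithinAt)
      (fun t ht => (hd t (Ico_subset_Icc_self ht)).hasDerivWithinAt) (by simp [hφ, h1]) ?_ 1
      (by simp)
    · simpa using this
    · intro t ht
      have hb1 := (hball _ (hmem t (Ico_subset_Icc_self ht))).1
      set y := φ 1 + t • (x - φ 1)
      calc _ ≤ ‖lderiv (E := E) b (φ.symm y)‖ * (‖chartForm (E := E) N y‖ * ‖x - φ 1‖) :=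
            (ContinuousLinearMap.le_opNorm _ _).trans (by gcongr; exact ContinuousLinearMap.le_opNorm _ _)
        _ ≤ (C * ‖b (φ.symm y)‖) * (M * ‖x - φ 1‖) := by
            have := hC (φ.symm y)
            gcongr
            exact (norm_nonneg _).trans this
        _ = _ := by ring
  have hc : Tendsto φ (𝓝 1) (𝓝 (φ 1)) := continuousAt_extChartAt (I := 𝓘(ℝ, E)) (1 : N)
  filter_upwards [hc.eventually (Metric.ball_mem_nhds _ hr),
    extChartAt_source_mem_nhds (I := 𝓘(ℝ, E)) (1 : N)] with g hg hg'
  have := key _ hg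
  rwa [φ.left_inv hg'] at this

/-- The zero set is clopen: the bound is invariant under left translation, so the local statement at
the identity applies around every zero. -/
theorem eq_zero_of_lderiv_bound [PreconnectedSpace N] {b : N → F}
    (hb : ContMDiff 𝓘(ℝ, E) 𝓘(ℝ, F) ∞ b) {C : ℝ}
    (hC : ∀ g, ‖lderiv (E := E) b g‖ ≤ C * ‖b g‖) (h1 : b 1 = 0) (g : N) : b g = 0 := by
  have hclosed : IsClosed {g | b g = 0} := isClosed_singleton.preimage hb.continuous
  have hopen : IsOpen {g | b g = 0} := by
    rw [isOpen_iff_mem_nhds]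
    intro g hg
    have h2 := eventually_eq_zero_of_lderiv_bound (b := fun z => b (g * z))
      (hb.comp contMDiff_mul_left) (C := C) (fun z => by
        rw [lderiv_comp_mul_left]; exact hC _) (by simpa using hg)
    have hc : Tendsto (fun z => g⁻¹ * z) (𝓝 g) (𝓝 1) := by
      have := (contMDiff_mul_left (I := 𝓘(ℝ, E)) (n := ∞) (a := g⁻¹)).continuous.tendsto g
      simpa using this
    filter_upwards [hc.eventually h2] with z hz
    simpa using hz
  have : {g | b g = 0} = univ := IsClopen.eq_univ ⟨hclosed, hopen⟩ ⟨1, h1⟩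
  exact this.ge (mem_univ g)

theorem derivOne_clm_comp {G : Type*} [NormedAddCommGroup G] [NormedSpace ℝ G]
    (L : F →L[ℝ] G) {u : N → F} (hu : MDifferentiableAt 𝓘(ℝ, E) 𝓘(ℝ, F) u 1) :
    derivOne (E := E) (fun h => L (u h)) = L.comp (derivOne u) := by
  have hLu : MDifferentiableAt 𝓘(ℝ, E) 𝓘(ℝ, G) (fun h => L (u h)) 1 :=
    MDifferentiableAt.comp (I' := 𝓘(ℝ, F)) (1 : N) (g := L)
      L.differentiableAt.mdifferentiableAt hu
  rw [derivOne_eq_fderiv hu, derivOne_eq_fderiv hLu]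
  exact (L.hasFDerivAt.comp _ (differentiableAt_comp_chart_symm hu).hasFDerivAt).fderiv

theorem lderiv_sub {u v : N → F} {g : N} (hu : MDifferentiableAt 𝓘(ℝ, E) 𝓘(ℝ, F) u g)
    (hv : MDifferentiableAt 𝓘(ℝ, E) 𝓘(ℝ, F) v g) :
    lderiv (E := E) (fun z => u z - v z) g = lderiv u g - lderiv v g := by
  have h1 := mdifferentiableAt_comp_mul_left hu
  have h2 := mdifferentiableAt_comp_mul_left hv
  have h3 : MDifferentiableAt 𝓘(ℝ, E) 𝓘(ℝ, F) (fun z => u (g * z) - v (g * z)) 1 := h1.sub h2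
  unfold lderiv
  rw [derivOne_eq_fderiv h1, derivOne_eq_fderiv h2, derivOne_eq_fderiv h3]
  exact fderiv_sub (differentiableAt_comp_chart_symm h1) (differentiableAt_comp_chart_symm h2)

theorem lderiv_const (x : F) (g : N) : lderiv (E := E) (fun _ : N => x) g = 0 := by
  unfold lderiv derivOne
  exact mfderiv_const

theorem eq_of_lderiv_eq_zero [PreconnectedSpace N] {b : N → F}
    (hb : ContMDiff 𝓘(ℝ, E) 𝓘(ℝ, F) ∞ b) (h0 : ∀ g, lderiv (E := E) b g = 0) (g : N) :
    b g = b 1 := by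
  have hc : ContMDiff 𝓘(ℝ, E) 𝓘(ℝ, F) ∞ (fun g => b g - b 1) := hb.sub contMDiff_const
  refine sub_eq_zero.1 (eq_zero_of_lderiv_bound hc (C := 0) (fun g => ?_) (by simp) g)
  have : lderiv (E := E) (fun g => b g - b 1) g = lderiv b g := by
    rw [lderiv_sub (hb.mdifferentiable (by simp) g) mdifferentiableAt_const, lderiv_const, sub_zero]
  rw [this, h0]; simp

/-- Let `P` project onto `V` and `Q = 1 - P`. Then `b(g) = Q Ad(g) P` vanishes at the identity and,
because `V` is an ideal, its derivative along `Z` is `b(g) ad(Z) P`. This linear equation forces `b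
= 0`. -/
theorem Ad_mem_of_ideal [FiniteDimensional ℝ E] [PreconnectedSpace N] {V : Submodule ℝ E}
    (hV : ∀ Z : E, ∀ W ∈ V, lieModel N Z W ∈ V) (g : N) {W : E} (hW : W ∈ V) : Ad g W ∈ V := by
  have : CompleteSpace E := FiniteDimensional.complete ℝ E
  obtain ⟨p, hp⟩ := LinearMap.exists_leftInverse_of_injective V.subtype (by simp)
  let P : E →L[ℝ] E := LinearMap.toContinuousLinearMap (V.subtype.comp p)
  have hP1 : ∀ w, P w ∈ V := fun w => (p w).2
  have hP2 : ∀ w ∈ V, P w = w := fun w hw =>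
    congrArg Subtype.val (LinearMap.congr_fun hp ⟨w, hw⟩)
  let Q : E →L[ℝ] E := ContinuousLinearMap.id ℝ E - P
  have hQ : ∀ w, Q w = 0 → w ∈ V := fun w hw => by
    have : w = P w := sub_eq_zero.1 (by simpa [Q] using hw)
    rw [this]; exact hP1 w
  let L : (E →L[ℝ] E) → (E →L[ℝ] E) →L[ℝ] (E →L[ℝ] E) := fun A =>
    (ContinuousLinearMap.compL ℝ E E E (Q.comp A)).comp ((ContinuousLinearMap.compL ℝ E E E).flip P)
  have hL : ∀ A B, L A B = (Q.comp A).comp (B.comp P) := fun A B => rfl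
  let b : N → (E →L[ℝ] E) := fun g => L (.id ℝ E) (Ad g)
  have hb : ContMDiff 𝓘(ℝ, E) 𝓘(ℝ, E →L[ℝ] E) ∞ b :=
    (L (.id ℝ E)).contDiff.contMDiff.comp contMDiff_Ad
  have hA : MDifferentiableAt 𝓘(ℝ, E) 𝓘(ℝ, E →L[ℝ] E) (fun h : N => Ad (E := E) h) 1 :=
    contMDiff_Ad.mdifferentiable (by simp) 1
  have hder : ∀ g Z, lderiv (E := E) b g Z =
      (b g).comp ((derivOne (E := E) (fun h : N => Ad (E := E) h) Z).comp P) := by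
    intro g Z
    have e : (fun z => b (g * z)) = fun z => L (Ad g) (Ad z) := by
      funext z
      simp only [b, hL, Ad_mul]
      rfl
    unfold lderiv
    rw [e, derivOne_clm_comp _ hA]
    ext w
    -- Since `ad(Z)` maps `V` to itself, a further `P` may be inserted in front of it, which makes
    -- `b(g)` reappear.
    have h1 : derivOne (E := E) (fun h : N => Ad (E := E) h) Z (P w) ∈ V := by
      rw [derivOne_Ad]; exact hV Z _ (hP1 w)
    simp only [b, hL, ContinuousLinearMap.comp_apply, ContinuousLinearMap.id_apply, hP2 _ h1]
  have hz : b g = 0 := by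
    refine eq_zero_of_lderiv_bound hb
      (C := ‖derivOne (E := E) (fun h : N => Ad (E := E) h)‖ * ‖P‖) (fun g => ?_) ?_ g
    · refine ContinuousLinearMap.opNorm_le_bound _ (by positivity) fun Z => ?_
      rw [hder]
      calc _ ≤ ‖b g‖ * (‖derivOne (E := E) (fun h : N => Ad (E := E) h) Z‖ * ‖P‖) :=
            (ContinuousLinearMap.opNorm_comp_le _ _).trans
              (by gcongr; exact ContinuousLinearMap.opNorm_comp_le _ _)
        _ ≤ ‖b g‖ * ((‖derivOne (E := E) (fun h : N => Ad (E := E) h)‖ * ‖Z‖) * ‖P‖) := by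
            gcongr; exact ContinuousLinearMap.le_opNorm _ _
        _ = _ := by ring
    · ext w
      simp only [b, hL, Ad_one, ContinuousLinearMap.comp_apply, ContinuousLinearMap.id_apply]
      simp [Q, hP2 _ (hP1 w)]
  apply hQ
  have := congrArg (fun A : E →L[ℝ] E => A W) hz
  simp only [b, hL, ContinuousLinearMap.comp_apply, ContinuousLinearMap.id_apply, hP2 _ hW] at this
  exact this

theorem derivOneMap_comp {u v : N → N} (hu : MDifferentiableAt 𝓘(ℝ, E) 𝓘(ℝ, E) u 1)
    (hv : MDifferentiableAt 𝓘(ℝ, E) 𝓘(ℝ, E) v 1) (hv1 : v 1 = 1) :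
    derivOneMap (E := E) (fun z => u (v z)) = (derivOneMap u).comp (derivOneMap v) := by
  ext W
  exact mfderiv_comp_apply_of_eq (I := 𝓘(ℝ, E)) (I' := 𝓘(ℝ, E)) (I'' := 𝓘(ℝ, E)) (x := (1 : N))
    (y := 1) hu hv hv1 W

theorem derivOneMap_mul {u v : N → N} (hu : MDifferentiableAt 𝓘(ℝ, E) 𝓘(ℝ, E) u 1)
    (hv : MDifferentiableAt 𝓘(ℝ, E) 𝓘(ℝ, E) v 1) (hu1 : u 1 = 1) (hv1 : v 1 = 1) :
    derivOneMap (E := E) (fun z => u z * v z) = derivOneMap u + derivOneMap v := by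
  ext W
  have hm : MDifferentiableAt (𝓘(ℝ, E).prod 𝓘(ℝ, E)) 𝓘(ℝ, E) (fun p : N × N => p.1 * p.2) (1, 1) :=
    (contMDiff_mul 𝓘(ℝ, E) ∞).mdifferentiable (by simp) _
  have h1 := mfderiv_comp_apply_of_eq (I := 𝓘(ℝ, E)) (I' := 𝓘(ℝ, E).prod 𝓘(ℝ, E)) (I'' := 𝓘(ℝ, E))
    (x := (1 : N)) (y := ((1, 1) : N × N)) (f := fun z => (u z, v z)) hm (hu.prodMk hv)
    (by rw [hu1, hv1]) W
  refine Eq.trans h1 ?_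
  have h2 := hu.mfderiv_prod hv
  refine (congrArg (fun A : E →L[ℝ] E × E =>
    (mfderiv (𝓘(ℝ, E).prod 𝓘(ℝ, E)) 𝓘(ℝ, E) (fun p : N × N => p.1 * p.2) (1, 1) :
      E × E →L[ℝ] E) (A W)) h2).trans ?_
  refine (mfderiv_prod_eq_add_apply hm
    (v := ((derivOneMap u W, derivOneMap v W) : E × E))).trans ?_
  have e1 : derivOneMap (E := E) (fun z : N => z * 1) = ContinuousLinearMap.id ℝ E := by
    simp only [mul_one]; exact mfderiv_id
  have e2 : derivOneMap (E := E) (fun z : N => 1 * z) = ContinuousLinearMap.id ℝ E := by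
    simp only [one_mul]; exact mfderiv_id
  exact congrArg₂ (· + ·) (congrArg (fun A : E →L[ℝ] E => A (derivOneMap u W)) e1)
    (congrArg (fun A : E →L[ℝ] E => A (derivOneMap v W)) e2)

theorem derivOneMap_commutator (g : N) :
    derivOneMap (E := E) (fun z => g * z * g⁻¹ * z⁻¹) = Ad g - ContinuousLinearMap.id ℝ E := by
  have hc : ContMDiff 𝓘(ℝ, E) 𝓘(ℝ, E) ∞ (fun z : N => g * z * g⁻¹ * z⁻¹) :=
    ((contMDiff_const.mul contMDiff_id).mul contMDiff_const).mul contMDiff_id.inv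
  have h := derivOneMap_mul (E := E) (u := fun z : N => g * z * g⁻¹ * z⁻¹) (v := fun z => z)
    (hc.mdifferentiable (by simp) 1) mdifferentiableAt_id (by simp) rfl
  have hid : derivOneMap (E := E) (fun z : N => z) = ContinuousLinearMap.id ℝ E := by
    unfold derivOneMap; exact mfderiv_id
  rw [eq_sub_iff_add_eq, ← hid, ← h]
  simp [Ad]

/-- In a nilpotent group the adjoint action is unipotent. -/
theorem exists_Ad_sub_id_pow_eq_zero [Group.IsNilpotent N] :
    ∃ m : ℕ, ∀ g : N, (Ad (E := E) g - 1) ^ m = 0 := by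
  obtain ⟨m, hm⟩ := Subgroup.nilpotent_iff_lowerCentralSeries.1 (inferInstance : Group.IsNilpotent N)
  refine ⟨m, fun g => ?_⟩
  -- The commutator map with `g` has derivative `Ad g - 1` at the identity. Its iterates descend the
  -- lower central series, so some iterate, with a number of steps independent of `g`, is constant.
  let κ : N → N := fun z => g * z * g⁻¹ * z⁻¹
  have hc : ContMDiff 𝓘(ℝ, E) 𝓘(ℝ, E) ∞ κ :=
    ((contMDiff_const.mul contMDiff_id).mul contMDiff_const).mul contMDiff_id.inv
  have hκ : ∀ k z, κ^[k] z ∈ (⊤ : Subgroup N).lowerCentralSeries k := by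
    intro k
    induction k with
    | zero => simp
    | succ k ih =>
      intro z
      rw [Function.iterate_succ_apply']
      have h := Subgroup.inv_mem _ (Subgroup.commutator_mem_commutator (ih z) (Subgroup.mem_top g))
      rwa [commutatorElement_inv] at h
  have hd : ∀ k, ContMDiff 𝓘(ℝ, E) 𝓘(ℝ, E) ∞ κ^[k] ∧ κ^[k] 1 = 1 ∧
      derivOneMap (E := E) κ^[k] = (Ad g - 1) ^ k := by
    intro k
    induction k with
    | zero => exact ⟨contMDiff_id, rfl, mfderiv_id⟩
    | succ k ih =>
      obtain ⟨h1, h2, h3⟩ := ih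
      rw [Function.iterate_succ]
      refine ⟨h1.comp hc, by simp [κ, h2], ?_⟩
      refine (derivOneMap_comp (h1.mdifferentiable (by simp) 1) (hc.mdifferentiable (by simp) 1)
        (by simp [κ])).trans ?_
      rw [h3, derivOneMap_commutator, pow_succ]
      rfl
  rw [← (hd m).2.2]
  have e : κ^[m] = fun _ => 1 := by
    funext z
    simpa [hm] using hκ m z
  rw [e]
  exact mfderiv_const

end Gronwall

/-! ### One-parameter subgroups and moving exponentials -/

section OneParameter

variable {E : Type*} [NormedAddCommGroup E] [NormedSpace ℝ E] [FiniteDimensional ℝ E]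
  {N : Type*} [TopologicalSpace N] [T2Space N] [ChartedSpace E N] [Group N]
  [LieGroup 𝓘(ℝ, E) ∞ N]
  {F : Type*} [NormedAddCommGroup F] [NormedSpace ℝ F]

/-- The one-parameter subgroup generated by `X`. -/
noncomputable def oneParam (X : GroupLieAlgebra 𝓘(ℝ, E) N) (t : ℝ) : N := lieExp (t • X)

theorem isMIntegralCurve_oneParam (X : GroupLieAlgebra 𝓘(ℝ, E) N) :
    IsMIntegralCurve (oneParam X) (mulInvariantVectorField X) := by
  obtain ⟨γ, h0, hγ⟩ := exists_integralCurve X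
  have : oneParam X = γ := by
    funext t
    have h := hγ.comp_mul t
    rw [← mulInvariantVectorField_smul] at h
    simpa [oneParam] using lieExp_eq (t • X) _ (by simp [h0]) h
  rwa [this]

theorem oneParam_zero (X : GroupLieAlgebra 𝓘(ℝ, E) N) : oneParam X 0 = 1 := by
  obtain ⟨γ, h0, hγ⟩ := exists_integralCurve X
  have h := hγ.comp_mul 0
  rw [← mulInvariantVectorField_smul] at h
  simpa [h0, oneParam] using lieExp_eq ((0 : ℝ) • X) _ (by simp [h0]) h

theorem oneParam_one (X : GroupLieAlgebra 𝓘(ℝ, E) N) : oneParam X 1 = lieExp X := by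
  simp [oneParam]

theorem oneParam_smul (X : GroupLieAlgebra 𝓘(ℝ, E) N) (a t : ℝ) :
    oneParam (a • X) t = oneParam X (t * a) := by
  simp [oneParam, smul_smul]

theorem continuous_oneParam (X : GroupLieAlgebra 𝓘(ℝ, E) N) : Continuous (oneParam X) :=
  (isMIntegralCurve_oneParam X).continuous

theorem isMIntegralCurve_mul_left {X : GroupLieAlgebra 𝓘(ℝ, E) N} {γ : ℝ → N}
    (hγ : IsMIntegralCurve γ (mulInvariantVectorField X)) (x : N) :
    IsMIntegralCurve (fun t => x * γ t) (mulInvariantVectorField X) := by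
  intro t
  have hd : MDifferentiableAt 𝓘(ℝ, E) 𝓘(ℝ, E) (fun y : N => x * y) (γ t) :=
    (contMDiff_mul_left (I := 𝓘(ℝ, E)) (n := ∞) (a := x)).mdifferentiable (by simp) _
  have h2 := hd.hasMFDerivAt.comp t (hγ t)
  have h3 : ContinuousLinearMap.smulRight (1 : ℝ →L[ℝ] ℝ) (mulInvariantVectorField X (x * γ t)) =
      (mfderiv 𝓘(ℝ, E) 𝓘(ℝ, E) (fun y : N => x * y) (γ t)).comp
        (ContinuousLinearMap.smulRight (1 : ℝ →L[ℝ] ℝ) (mulInvariantVectorField X (γ t))) := by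
    rw [mulInvariantVectorField_mul]
    refine ContinuousLinearMap.ext fun r => ?_
    exact ((mfderiv 𝓘(ℝ, E) 𝓘(ℝ, E) (fun y : N => x * y) (γ t)).map_smul r
      (mulInvariantVectorField X (γ t))).symm
  rw [h3]
  exact h2

theorem oneParam_add (X : GroupLieAlgebra 𝓘(ℝ, E) N) (s t : ℝ) :
    oneParam X (s + t) = oneParam X s * oneParam X t := by
  have : CompleteSpace E := FiniteDimensional.complete ℝ E
  have : IsManifold 𝓘(ℝ, E) ∞ N := inferInstance
  have : IsManifold 𝓘(ℝ, E) 1 N := .of_le (n := ∞) (by simp)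
  have h1 := (isMIntegralCurve_oneParam X).comp_add s
  have h2 := isMIntegralCurve_mul_left (isMIntegralCurve_oneParam X) (oneParam X s)
  have h := isMIntegralCurve_Ioo_eq_of_contMDiff_boundaryless (t₀ := 0)
    (contMDiff_invariantField X) h1 h2 (by simp [oneParam_zero])
  have := congrFun h t
  simpa [add_comm] using this

/-- The chain rule in the two factors. The velocity `A` has to pass `h` and the second factor to
become a left-invariant derivative at the endpoint, whence the `Ad` of the inverse. -/
theorem hasDerivAt_comp_oneParam_oneParam {f : N → F} (hf : MDifferentiable 𝓘(ℝ, E) 𝓘(ℝ, F) f)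
    (A B : GroupLieAlgebra 𝓘(ℝ, E) N) (g h : N) (s : ℝ) :
    HasDerivAt (fun s => f (g * oneParam A s * h * oneParam B s))
      (lderiv (E := E) f (g * oneParam A s * h * oneParam B s)
        (Ad (h * oneParam B s)⁻¹ A) +
        lderiv (E := E) f (g * oneParam A s * h * oneParam B s) B) s := by
  have hm : ContMDiff (𝓘(ℝ, E).prod 𝓘(ℝ, E)) 𝓘(ℝ, E) ∞ (fun p : N × N => g * p.1 * h * p.2) :=
    ((contMDiff_const.mul contMDiff_fst).mul contMDiff_const).mul contMDiff_snd
  have hΨ : MDifferentiable (𝓘(ℝ, E).prod 𝓘(ℝ, E)) 𝓘(ℝ, F)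
      (fun p : N × N => f (g * p.1 * h * p.2)) := fun p =>
    MDifferentiableAt.comp (I' := 𝓘(ℝ, E)) p (hf _) (hm.mdifferentiable (by simp) p)
  have hγ := (isMIntegralCurve_oneParam A s).prodMk (isMIntegralCurve_oneParam B s)
  let D : E × E →L[ℝ] F := mfderiv (𝓘(ℝ, E).prod 𝓘(ℝ, E)) 𝓘(ℝ, F)
    (fun p : N × N => f (g * p.1 * h * p.2)) (oneParam A s, oneParam B s)
  let v : ℝ →L[ℝ] E × E := (ContinuousLinearMap.smulRight (1 : ℝ →L[ℝ] ℝ)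
    (mulInvariantVectorField A (oneParam A s) : E)).prod
    (ContinuousLinearMap.smulRight (1 : ℝ →L[ℝ] ℝ) (mulInvariantVectorField B (oneParam B s) : E))
  have h1 : HasFDerivAt (fun s => f (g * oneParam A s * h * oneParam B s)) (D.comp v) s :=
    (HasMFDerivAt.comp (g := fun p : N × N => f (g * p.1 * h * p.2)) s
      (hΨ (oneParam A s, oneParam B s)).hasMFDerivAt hγ).hasFDerivAt
  refine h1.hasDerivAt.congr_deriv ?_
  have h2 := mfderiv_prod_eq_add_apply (hΨ (oneParam A s, oneParam B s))
    (v := (((1 : ℝ) • (mulInvariantVectorField A (oneParam A s) : E),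
      (1 : ℝ) • (mulInvariantVectorField B (oneParam B s) : E)) : E × E))
  refine Eq.trans h2 ?_
  have hd1 : MDifferentiable 𝓘(ℝ, E) 𝓘(ℝ, F) (fun y => f (g * y)) := fun y =>
    MDifferentiableAt.comp (I' := 𝓘(ℝ, E)) y (hf _)
      ((contMDiff_mul_left (I := 𝓘(ℝ, E)) (n := ∞)).mdifferentiable (by simp) y)
  have hd2 : MDifferentiable 𝓘(ℝ, E) 𝓘(ℝ, F) (fun y => f (g * y * h * oneParam B s)) := fun y =>
    MDifferentiableAt.comp (I' := 𝓘(ℝ, E)) y (hf _)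
      ((((contMDiff_const.mul contMDiff_id).mul contMDiff_const).mul contMDiff_const :
        ContMDiff 𝓘(ℝ, E) 𝓘(ℝ, E) ∞ (fun y => g * y * h * oneParam B s)).mdifferentiable
          (by simp) y)
  have hd3 : MDifferentiable 𝓘(ℝ, E) 𝓘(ℝ, F) (fun y => f (g * oneParam A s * h * y)) := fun y =>
    MDifferentiableAt.comp (I' := 𝓘(ℝ, E)) y (hf _)
      ((contMDiff_mul_left (I := 𝓘(ℝ, E)) (n := ∞)).mdifferentiable (by simp) y)
  have e1 := lderiv_apply_eq_mulInvariantVectorField (oneParam A s) (hd2 _) A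
  have e2 := lderiv_apply_eq_mulInvariantVectorField (oneParam B s) (hd3 _) B
  rw [one_smul, one_smul]
  refine (congrArg₂ (· + ·) e1 e2).symm.trans ?_
  refine congrArg₂ (· + ·) ?_ ?_
  · have e3 : (fun y => f (g * y * h * oneParam B s)) =
        fun y => (fun w => f (g * w)) (y * (h * oneParam B s)) := by
      funext y; simp [mul_assoc]
    rw [e3, lderiv_comp_mul_right (hd1 _), lderiv_comp_mul_left]
    simp only [mul_assoc]
    rfl
  · rw [lderiv_comp_mul_left]

theorem hasDerivAt_comp_oneParam {f : N → F} (hf : MDifferentiable 𝓘(ℝ, E) 𝓘(ℝ, F) f)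
    (A : GroupLieAlgebra 𝓘(ℝ, E) N) (g : N) (s : ℝ) :
    HasDerivAt (fun s => f (g * oneParam A s)) (lderiv (E := E) f (g * oneParam A s) A) s := by
  have h := hasDerivAt_comp_oneParam_oneParam hf A 0 g 1 s
  have h0 : ∀ t, oneParam (0 : GroupLieAlgebra 𝓘(ℝ, E) N) t = 1 := fun t => by
    have := oneParam_smul (0 : GroupLieAlgebra 𝓘(ℝ, E) N) 0 t
    rwa [smul_zero, mul_zero, oneParam_zero] at this
  simp only [h0, mul_one, inv_one, Ad_one] at h
  refine h.congr_deriv ?_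
  have : lderiv (E := E) f (g * oneParam A s) (0 : E) = 0 := map_zero _
  exact (congrArg _ this).trans (add_zero _)

/-- If `f` is killed by `V` and `A` is conjugate to `B` modulo `V` under the whole group, then
`exp A` can be moved across any group element, becoming `exp B`. -/
theorem comp_lieExp_mul_eq {V : Submodule ℝ E} {f : N → F} (hf : ContMDiff 𝓘(ℝ, E) 𝓘(ℝ, F) ∞ f)
    (hV : ∀ W ∈ V, ∀ g, lderiv (E := E) f g W = 0) (A B : E)
    (hAB : ∀ h : N, Ad h A - B ∈ V) (g h : N) :
    f (g * lieExp (N := N) A * h) = f (g * h * lieExp (N := N) B) := by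
  let A' : GroupLieAlgebra 𝓘(ℝ, E) N := A
  let B' : GroupLieAlgebra 𝓘(ℝ, E) N := B
  -- The path joins `g h exp(B)` at `s = 0` to `g exp(A) h` at `s = 1`. Its left-invariant velocity
  -- is a conjugate of `A` minus `B`, which lies in `V`.
  have hd : ∀ s, HasDerivAt
      (fun s => f (g * oneParam A' s * (h * lieExp B') * oneParam (-B') s)) 0 s := by
    intro s
    refine (hasDerivAt_comp_oneParam_oneParam (hf.mdifferentiable (by simp)) A' (-B') g
      (h * lieExp B') s).congr_deriv ?_
    have h1 := hV _ (hAB (h * lieExp B' * oneParam (-B') s)⁻¹)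
      (g * oneParam A' s * (h * lieExp B') * oneParam (-B') s)
    rw [map_sub, sub_eq_add_neg, ← map_neg] at h1
    exact h1
  have h2 := is_const_of_deriv_eq_zero (fun s => (hd s).differentiableAt) (fun s => (hd s).deriv) 1 0
  have e : lieExp B' * lieExp (-B') = 1 := by
    rw [← oneParam_one (-B')]
    have h3 := oneParam_smul B' (-1) 1
    rw [neg_smul, one_smul] at h3
    rw [h3, ← oneParam_one B', ← oneParam_add]
    simp [oneParam_zero]
  simp only [mul_assoc, e, oneParam_zero, oneParam_one, mul_one] at h2
  change f (g * lieExp A' * h) = f (g * h * lieExp B')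
  simpa only [mul_assoc] using h2

end OneParameter

/-! ### Smoothness of integrals over right translates -/

section ParametricIntegral

universe u

variable {E : Type u} [NormedAddCommGroup E] [NormedSpace ℝ E]
  {N : Type*} [TopologicalSpace N] [ChartedSpace E N] [Group N] [LieGroup 𝓘(ℝ, E) ∞ N]

theorem contDiffAt_comp_chart_symm {F : Type*} [NormedAddCommGroup F] [NormedSpace ℝ F]
    {b : N → F} {n : ℕ∞} (hb : ContMDiffAt 𝓘(ℝ, E) 𝓘(ℝ, F) n b 1) :
    ContDiffAt ℝ n (b ∘ (extChartAt 𝓘(ℝ, E) (1 : N)).symm) (extChartAt 𝓘(ℝ, E) (1 : N) 1) :=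
  (ContMDiffAt.comp _ (g := b) (by rwa [extChartAt_to_inv])
    (contMDiffAt_chart_symm.of_le (by exact_mod_cast le_top))).contDiffAt

theorem contMDiffAt_of_comp_chart_symm {F : Type*} [NormedAddCommGroup F] [NormedSpace ℝ F]
    {b : N → F} {n : ℕ∞}
    (hb : ContDiffAt ℝ n (b ∘ (extChartAt 𝓘(ℝ, E) (1 : N)).symm) (extChartAt 𝓘(ℝ, E) (1 : N) 1)) :
    ContMDiffAt 𝓘(ℝ, E) 𝓘(ℝ, F) n b 1 := by
  have hφ : ContMDiffAt 𝓘(ℝ, E) 𝓘(ℝ, E) n (extChartAt 𝓘(ℝ, E) (1 : N)) 1 :=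
    (contMDiffAt_extChartAt (n := ∞)).of_le (by exact_mod_cast le_top)
  refine (ContMDiffAt.comp (1 : N) (g := b ∘ (extChartAt 𝓘(ℝ, E) (1 : N)).symm)
    hb.contMDiffAt hφ).congr_of_eventuallyEq ?_
  filter_upwards [extChartAt_source_mem_nhds (I := 𝓘(ℝ, E)) (1 : N)] with g hg
  simp only [Function.comp_apply]
  rw [PartialEquiv.left_inv _ hg]

variable [FiniteDimensional ℝ E]

/-- The right Maurer-Cartan form in the chart at the identity. -/
noncomputable def rightChartForm (N : Type*) [TopologicalSpace N] [ChartedSpace E N] [Group N]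
    (x : E) : E →L[ℝ] E :=
  (Ad ((extChartAt 𝓘(ℝ, E) (1 : N)).symm x)).comp (chartForm N x)

theorem contDiffAt_rightChartForm :
    ContDiffAt ℝ ∞ (rightChartForm (E := E) N) (extChartAt 𝓘(ℝ, E) (1 : N) 1) :=
  (contDiffAt_comp_chart_symm contMDiff_Ad.contMDiffAt).clm_comp contDiffAt_chartForm

/-- Right-invariant derivatives commute with right translation by `e t`. The derivative is therefore
an integral of the same shape, with `rderiv f` in place of `f`, times a smooth form independent of
`t`, and induction on the order of smoothness can run. -/
theorem exists_hasFDerivAt_integral {F : Type*} [NormedAddCommGroup F] [NormedSpace ℝ F]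
    [CompleteSpace F]
    {f : N → F} (hf : ContMDiff 𝓘(ℝ, E) 𝓘(ℝ, F) ∞ f) {K : ℝ → ℝ} (hK : Continuous K) {e : ℝ → N}
    (he : Continuous e) :
    ∃ s ∈ 𝓝 (extChartAt 𝓘(ℝ, E) (1 : N) 1), ∀ x ∈ s, HasFDerivAt
      ((fun g => ∫ t in (0 : ℝ)..1, K t • f (g * e t)) ∘ (extChartAt 𝓘(ℝ, E) (1 : N)).symm)
      ((∫ t in (0 : ℝ)..1, K t • rderiv (E := E) f ((extChartAt 𝓘(ℝ, E) (1 : N)).symm x * e t)).comp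
        (rightChartForm N x)) x := by
  have : ProperSpace E := FiniteDimensional.proper_real E
  have : IsTopologicalGroup N := topologicalGroup_of_lieGroup 𝓘(ℝ, E) ∞
  set φ := extChartAt 𝓘(ℝ, E) (1 : N) with hφ
  set M := ‖rightChartForm (E := E) N (φ 1)‖ + 1 with hM
  have e1 : ∀ᶠ x in 𝓝 (φ 1), ‖rightChartForm (E := E) N x‖ < M :=
    contDiffAt_rightChartForm.continuousAt.norm.eventually (gt_mem_nhds (by simp [hM, hφ]))
  obtain ⟨r, hr, hball⟩ := Metric.nhds_basis_closedBall.eventually_iff.1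
    (e1.and (extChartAt_target_mem_nhds (I := 𝓘(ℝ, E)) (1 : N)))
  have hsymm : ContinuousOn φ.symm (Metric.closedBall (φ 1) r) :=
    (continuousOn_extChartAt_symm (I := 𝓘(ℝ, E)) (1 : N)).mono fun x hx => (hball hx).2
  have hrf : Continuous (rderiv (E := E) f) :=
    continuous_iff_continuousAt.2 fun g => (contMDiffAt_rderiv (hf g)).continuousAt
  obtain ⟨B, hB⟩ := ((isCompact_closedBall (φ 1) r).prod
    (isCompact_Icc (a := (0 : ℝ)) (b := 1))).exists_bound_of_continuousOn
    (f := fun p : E × ℝ => K p.2 • rderiv (E := E) f (φ.symm p.1 * e p.2)) (by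
      refine (hK.comp continuous_snd).continuousOn.smul (hrf.comp_continuousOn ?_)
      exact (hsymm.comp continuousOn_fst fun p hp => hp.1).mul (he.comp continuous_snd).continuousOn)
  refine ⟨Metric.ball (φ 1) r, Metric.ball_mem_nhds _ hr, fun x hx => ?_⟩
  have hc : ∀ g : N, Continuous fun t => K t • f (g * e t) := fun g =>
    hK.smul (hf.continuous.comp (continuous_const.mul he))
  have hc' : ∀ g : N, Continuous fun t => K t • rderiv (E := E) f (g * e t) := fun g =>
    hK.smul (hrf.comp (continuous_const.mul he))
  have h := intervalIntegral.hasFDerivAt_integral_of_dominated_of_fderiv_le (μ := volume) (𝕜 := ℝ)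
    (a := 0) (b := 1) (x₀ := x) (s := Metric.ball (φ 1) r) (bound := fun _ => B * M)
    (F := fun x t => K t • f (φ.symm x * e t))
    (F' := fun x t => (K t • rderiv (E := E) f (φ.symm x * e t)).comp (rightChartForm N x))
    (Metric.isOpen_ball.mem_nhds hx)
    (Eventually.of_forall fun y => (hc _).aestronglyMeasurable)
    ((hc _).intervalIntegrable _ _)
    ((hc' _).clm_comp continuous_const).aestronglyMeasurable
    (Eventually.of_forall fun t ht y hy => ?_) (by simp) (Eventually.of_forall fun t ht y hy => ?_)
  · refine h.congr_fderiv ?_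
    have := ((ContinuousLinearMap.compL ℝ E E F).flip (rightChartForm N x)).intervalIntegral_comp_comm
      ((hc' (φ.symm x)).intervalIntegrable (μ := volume) 0 1)
    exact this
  · rw [uIoc_of_le zero_le_one] at ht
    have hy' := Metric.ball_subset_closedBall hy
    refine (ContinuousLinearMap.opNorm_comp_le _ _).trans ?_
    have h1 := hB (y, t) ⟨hy', Ioc_subset_Icc_self ht⟩
    exact mul_le_mul h1 (hball hy').1.le (norm_nonneg _) ((norm_nonneg _).trans h1)
  · have hb : ContMDiff 𝓘(ℝ, E) 𝓘(ℝ, F) ∞ (fun z => f (z * e t)) := hf.comp contMDiff_mul_right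
    have h2 := fderiv_comp_chart_symm hb (hball (Metric.ball_subset_closedBall hy)).2
    rw [lderiv_eq_rderiv_comp_Ad (hb.mdifferentiable (by simp) _)] at h2
    have h3 : rderiv (E := E) (fun z => f (z * e t)) (φ.symm y) = rderiv f (φ.symm y * e t) := by
      simp only [rderiv, mul_assoc]
    rw [h3] at h2
    exact h2.const_smul (K t)

theorem contMDiffAt_integral_succ {F : Type*} [NormedAddCommGroup F] [NormedSpace ℝ F]
    [CompleteSpace F]
    {f : N → F} (hf : ContMDiff 𝓘(ℝ, E) 𝓘(ℝ, F) ∞ f) {K : ℝ → ℝ} (hK : Continuous K) {e : ℝ → N}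
    (he : Continuous e) (n : ℕ)
    (h : ContMDiffAt 𝓘(ℝ, E) 𝓘(ℝ, E →L[ℝ] F) n
      (fun g => ∫ t in (0 : ℝ)..1, K t • rderiv (E := E) f (g * e t)) 1) :
    ContMDiffAt 𝓘(ℝ, E) 𝓘(ℝ, F) (n + 1 : ℕ) (fun g => ∫ t in (0 : ℝ)..1, K t • f (g * e t)) 1 := by
  refine contMDiffAt_of_comp_chart_symm (n := (n + 1 : ℕ)) ?_
  refine (contDiffAt_succ_iff_hasFDerivAt (n := n)).2
    ⟨_, exists_hasFDerivAt_integral hf hK he, ?_⟩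
  exact (contDiffAt_comp_chart_symm (n := n) h).clm_comp
    (contDiffAt_rightChartForm.of_le (by exact_mod_cast le_top))

theorem contMDiffAt_integral_nat {K : ℝ → ℝ} (hK : Continuous K) {e : ℝ → N} (he : Continuous e)
    (n : ℕ) : ∀ {F : Type u} [NormedAddCommGroup F] [NormedSpace ℝ F] [CompleteSpace F]
      {f : N → F}, ContMDiff 𝓘(ℝ, E) 𝓘(ℝ, F) ∞ f →
    ContMDiffAt 𝓘(ℝ, E) 𝓘(ℝ, F) n (fun g => ∫ t in (0 : ℝ)..1, K t • f (g * e t)) 1 := by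
  induction n with
  | zero =>
    intro F _ _ _ f hf
    refine contMDiffAt_of_comp_chart_symm (n := (0 : ℕ)) ?_
    obtain ⟨s, hs, h⟩ := exists_hasFDerivAt_integral hf hK he
    exact contDiffAt_zero.2 ⟨s, hs, fun x hx => (h x hx).continuousAt.continuousWithinAt⟩
  | succ n ih =>
    intro F _ _ _ f hf
    exact contMDiffAt_integral_succ hf hK he n (ih fun g => contMDiffAt_rderiv (hf g))

theorem contMDiff_integral {f : N → ℝ} (hf : ContMDiff 𝓘(ℝ, E) 𝓘(ℝ, ℝ) ∞ f) {K : ℝ → ℝ}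
    (hK : Continuous K) {e : ℝ → N} (he : Continuous e) :
    ContMDiff 𝓘(ℝ, E) 𝓘(ℝ, ℝ) ∞ (fun g => ∫ t in (0 : ℝ)..1, K t * f (g * e t)) := by
  have : IsTopologicalGroup N := topologicalGroup_of_lieGroup 𝓘(ℝ, E) ∞
  intro g
  have h : ContMDiffAt 𝓘(ℝ, E) 𝓘(ℝ, ℝ) ∞ (fun z => ∫ t in (0 : ℝ)..1, K t * f (z * (g * e t))) 1 := by
    refine contMDiffAt_infty.2 fun n => ?_
    -- One derivative is taken before `contMDiffAt_integral_nat` is applied: that induction keeps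
    -- its values in the universe of `E`, where `E →L[ℝ] ℝ` lives but `ℝ` need not.
    refine ContMDiffAt.of_le ?_ (show (n : ℕ∞ω) ≤ (n + 1 : ℕ) by exact_mod_cast n.le_succ)
    exact contMDiffAt_integral_succ hf hK (e := fun t => g * e t) (continuous_const.mul he) n
      (contMDiffAt_integral_nat hK (e := fun t => g * e t) (continuous_const.mul he) n
        fun g => contMDiffAt_rderiv (hf g))
  have h2 : ContMDiffAt 𝓘(ℝ, E) 𝓘(ℝ, E) ∞ (fun z => z * g⁻¹) g := contMDiffAt_mul_right
  have h3 := ContMDiffAt.comp g (by rwa [mul_inv_cancel]) h2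
  refine h3.congr_of_eventuallyEq (Eventually.of_forall fun z => ?_)
  simp [mul_assoc]

end ParametricIntegral

/-! ### Small divisors on the circle -/

section Circle

theorem IsDiophantine.irrational {a : ℝ} (ha : IsDiophantine a) : Irrational a := by
  obtain ⟨C, hC, τ, hτ, h⟩ := ha
  rintro ⟨r, rfl⟩
  have h1 := h r.den (by exact_mod_cast r.den_ne_zero) r.num
  have h2 : ((r.den : ℤ) : ℝ) * (r : ℝ) - (r.num : ℝ) = 0 := by
    have := r.den_mul_eq_num
    have h3 : (r.den : ℝ) * (r : ℝ) = r.num := by exact_mod_cast this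
    push_cast
    rw [h3, sub_self]
  rw [h2, abs_zero] at h1
  have h3 : 0 < |((r.den : ℤ) : ℝ)| := by
    rw [abs_pos]; exact_mod_cast r.den_ne_zero
  have := Real.rpow_pos_of_pos h3 (-τ)
  nlinarith

/-- A continuous function with period `1` and an irrational period is constant. -/
theorem eq_of_periodic_irrational {a : ℝ} (ha : Irrational a) {u : ℝ → ℝ} (hu : Continuous u)
    (h1 : ∀ t, u (t + 1) = u t) (h2 : ∀ t, u (t + a) = u t) (t : ℝ) : u t = u 0 := by
  have hd : Dense (AddSubgroup.closure {a, 1} : Set ℝ) := by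
    rw [dense_addSubgroupClosure_pair_iff]; simpa using ha
  have hp : ∀ x ∈ AddSubgroup.closure ({a, 1} : Set ℝ), ∀ t, u (t + x) = u t := by
    intro x hx
    induction hx using AddSubgroup.closure_induction with
    | mem x hx =>
      rcases hx with rfl | rfl
      · exact h2
      · exact h1
    | zero => simp
    | add x y _ _ hx hy => intro t; rw [← add_assoc, hy, hx]
    | neg x _ hx => intro t; rw [← hx (t + -x)]; simp
  have : Continuous fun x => u x := hu
  exact congrFun (Continuous.ext_on hd hu continuous_const fun x hx => by
    simpa using hp x hx 0) t

/-- If `x` is `ma` minus its nearest integer, the norm is `2|sin(πx)|`, which is at least `4|x|` for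
`|x| ≤ 1/2`. -/
theorem lower_bound_exp {a : ℝ} (ha : IsDiophantine a) : ∃ C > (0 : ℝ), ∃ τ > (0 : ℝ), ∀ m : ℤ, m ≠ 0 →
    C * |(m : ℝ)| ^ (-τ) ≤ ‖Complex.exp (2 * Real.pi * Complex.I * m * a) - 1‖ := by
  obtain ⟨C, hC, τ, hτ, h⟩ := ha
  refine ⟨4 * C, by positivity, τ, hτ, fun m hm => ?_⟩
  have h1 := h m hm (round (m * a))
  set x := (m : ℝ) * a - round ((m : ℝ) * a) with hx
  have hx2 : |x| ≤ 1 / 2 := abs_sub_round _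
  have e : Complex.exp (2 * Real.pi * Complex.I * m * a) =
      Complex.exp (Complex.I * ((2 * Real.pi * x : ℝ) : ℂ)) := by
    rw [Complex.exp_eq_exp_iff_exists_int]
    refine ⟨round ((m : ℝ) * a), ?_⟩
    rw [hx]; push_cast; ring
  rw [e, Complex.norm_exp_I_mul_ofReal_sub_one]
  have h2 := Real.mul_abs_le_abs_sin (x := 2 * Real.pi * x / 2) (by
    rw [show 2 * Real.pi * x / 2 = Real.pi * x by ring, abs_mul, abs_of_pos Real.pi_pos]
    nlinarith [Real.pi_pos])
  have h3 : 2 / Real.pi * |2 * Real.pi * x / 2| = 2 * |x| := by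
    rw [show 2 * Real.pi * x / 2 = Real.pi * x by ring, abs_mul, abs_of_pos Real.pi_pos]
    field_simp
  rw [h3] at h2
  rw [norm_mul, Real.norm_eq_abs, Real.norm_eq_abs]
  simp only [abs_two]
  linarith

/-- Fourier coefficients of a function on the unit interval. -/
noncomputable def intervalCoeff (u : ℝ → ℝ) (m : ℤ) : ℂ :=
  ∫ t in (0 : ℝ)..1, Complex.exp (-(2 * Real.pi * Complex.I * m * t)) * (u t : ℂ)

theorem exp_two_pi_int (m : ℤ) : Complex.exp (-(2 * Real.pi * Complex.I * m)) = 1 := by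
  rw [Complex.exp_eq_one_iff]; exact ⟨-m, by push_cast; ring⟩

theorem hasDerivAt_character (m : ℤ) (t : ℝ) :
    HasDerivAt (fun t : ℝ => Complex.exp (-(2 * Real.pi * Complex.I * m * t)))
      (-(2 * Real.pi * Complex.I * m) * Complex.exp (-(2 * Real.pi * Complex.I * m * t))) t := by
  have h1 : HasDerivAt (fun t : ℝ => -(2 * Real.pi * Complex.I * m * (t : ℂ)))
      (-(2 * Real.pi * Complex.I * m)) t := by
    simpa using ((Complex.ofRealCLM.hasDerivAt (x := t)).const_mul (2 * Real.pi * Complex.I * m)).fun_neg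
  exact h1.cexp.congr_deriv (mul_comm _ _)

theorem continuous_character (m : ℤ) :
    Continuous (fun t : ℝ => Complex.exp (-(2 * Real.pi * Complex.I * m * t))) := by
  fun_prop

theorem intervalCoeff_deriv {u v : ℝ → ℝ} (hu : ∀ t, HasDerivAt u (v t) t) (hv : Continuous v)
    (hp : ∀ t, u (t + 1) = u t) (m : ℤ) :
    intervalCoeff v m = (2 * Real.pi * Complex.I * m) * intervalCoeff u m := by
  have h := intervalIntegral.integral_mul_deriv_eq_deriv_mul (a := 0) (b := 1)
    (u := fun t : ℝ => Complex.exp (-(2 * Real.pi * Complex.I * m * t)))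
    (v := fun t : ℝ => (u t : ℂ)) (v' := fun t : ℝ => (v t : ℂ))
    (fun t _ => hasDerivAt_character m t) (fun t _ => (hu t).ofReal_comp)
    ((continuous_const.mul (continuous_character m)).intervalIntegrable _ _)
    ((Complex.continuous_ofReal.comp hv).intervalIntegrable _ _)
  have h01 : u 1 = u 0 := by simpa using hp 0
  unfold intervalCoeff
  rw [h]
  simp only [Complex.ofReal_one, mul_one, exp_two_pi_int, Complex.ofReal_zero, mul_zero, neg_zero,
    Complex.exp_zero, h01, one_mul, sub_self, zero_sub]
  rw [← intervalIntegral.integral_const_mul, ← intervalIntegral.integral_neg]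
  congr 1; funext t; ring

theorem intervalCoeff_shift {u : ℝ → ℝ} (hp : ∀ t, u (t + 1) = u t) (m : ℤ) (a : ℝ) :
    intervalCoeff (fun t => u (a + t)) m =
      Complex.exp (2 * Real.pi * Complex.I * m * a) * intervalCoeff u m := by
  let G : ℝ → ℂ := fun t => Complex.exp (-(2 * Real.pi * Complex.I * m * t)) * (u t : ℂ)
  have hG : Function.Periodic G 1 := by
    intro t
    simp only [G, hp]
    congr 1
    rw [show -(2 * Real.pi * Complex.I * m * ((t + 1 : ℝ) : ℂ)) =
      -(2 * Real.pi * Complex.I * m * t) + -(2 * Real.pi * Complex.I * m) by push_cast; ring,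
      Complex.exp_add, exp_two_pi_int, mul_one]
  have h1 : ∫ t in (0 : ℝ)..1, G t = ∫ t in (0 : ℝ)..1, G (a + t) := by
    rw [intervalIntegral.integral_comp_add_left (fun t => G t)]
    have := hG.intervalIntegral_add_eq 0 a
    simpa using this
  unfold intervalCoeff
  rw [show (∫ t in (0 : ℝ)..1, Complex.exp (-(2 * Real.pi * Complex.I * m * t)) * (u t : ℂ)) =
    ∫ t in (0 : ℝ)..1, G (a + t) from h1, ← intervalIntegral.integral_const_mul]
  congr 1; funext t
  simp only [G]
  rw [← mul_assoc, ← Complex.exp_add]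
  congr 2; push_cast; ring

theorem norm_intervalCoeff_le {u : ℝ → ℝ} (hu : Continuous u) :
    ∃ B, ∀ m : ℤ, ‖intervalCoeff u m‖ ≤ B := by
  obtain ⟨B, hB⟩ := isCompact_Icc.exists_bound_of_continuousOn (s := Icc (0 : ℝ) 1) hu.continuousOn
  refine ⟨B, fun m => ?_⟩
  have := intervalIntegral.norm_integral_le_of_norm_le_const (a := (0 : ℝ)) (b := 1) (C := B)
    (f := fun t : ℝ => Complex.exp (-(2 * Real.pi * Complex.I * m * t)) * (u t : ℂ)) ?_
  · simpa [intervalCoeff] using this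
  · intro t ht
    rw [uIoc_of_le zero_le_one] at ht
    have e : -(2 * Real.pi * Complex.I * m * t) = ((-(2 * Real.pi * m * t) : ℝ) : ℂ) * Complex.I := by
      push_cast; ring
    rw [norm_mul, e, Complex.norm_exp_ofReal_mul_I, one_mul, Complex.norm_real]
    exact hB t (Ioc_subset_Icc_self ht)

theorem summable_inv_sq_int : Summable fun m : ℤ => (|(m : ℝ)| ^ 2)⁻¹ := by
  have := Real.summable_one_div_int_pow.2 one_lt_two
  simpa using this

theorem norm_two_pi_I_mul (m : ℤ) : ‖(2 * Real.pi * Complex.I * m : ℂ)‖ = 2 * Real.pi * |(m : ℝ)| := by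
  simp [Real.pi_pos.le]

/-- Two integrations by parts bound the coefficients by a multiple of `m⁻²`, so the Fourier series
converges to the function at 0. -/
theorem hasSum_intervalCoeff {u : ℕ → ℝ → ℝ} (hu : ∀ j t, HasDerivAt (u j) (u (j + 1) t) t)
    (hp : ∀ t, u 0 (t + 1) = u 0 t) : HasSum (intervalCoeff (u 0)) (u 0 0 : ℂ) := by
  have hc : ∀ j, Continuous (u j) := fun j =>
    continuous_iff_continuousAt.2 fun t => (hu j t).continuousAt
  have hp1 : ∀ t, u 1 (t + 1) = u 1 t := fun t => by
    have h1 := (hu 0 (t + 1)).comp_add_const t 1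
    simp only [hp] at h1
    exact h1.unique (hu 0 t)
  have hper : Function.Periodic (fun t => (u 0 t : ℂ)) (1 : ℝ) := fun t => by simp [hp]
  let f : C(AddCircle (1 : ℝ), ℂ) := ⟨hper.lift,
    continuous_coinduced_dom.mpr (Complex.continuous_ofReal.comp (hc 0))⟩
  have : Fact ((0 : ℝ) < 1) := ⟨one_pos⟩
  have hf : fourierCoeff f = intervalCoeff (u 0) := by
    funext m
    rw [fourierCoeff_eq_intervalIntegral _ _ 0]
    unfold intervalCoeff
    simp only [zero_add, div_one, one_smul, fourier_coe_apply]
    congr 1; funext t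
    change _ • ((u 0 t : ℂ)) = _
    rw [smul_eq_mul]
    congr 2; push_cast; simp
  obtain ⟨B, hB⟩ := norm_intervalCoeff_le (hc 2)
  have hs : Summable (fourierCoeff f) := by
    rw [hf]
    refine Summable.of_norm_bounded_eventually (g := fun m : ℤ => B * (|(m : ℝ)| ^ 2)⁻¹)
      (summable_inv_sq_int.mul_left B) ?_
    rw [Filter.eventually_cofinite]
    refine (Set.finite_singleton (0 : ℤ)).subset fun m hm => ?_
    by_contra h0
    apply hm
    have h0' : m ≠ 0 := h0
    have hB0 : 0 ≤ B := (norm_nonneg _).trans (hB 0)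
    have h2 := hB m
    rw [intervalCoeff_deriv (hu 1) (hc 2) hp1, intervalCoeff_deriv (hu 0) (hc 1) hp, norm_mul,
      norm_mul (2 * Real.pi * Complex.I * m : ℂ), norm_two_pi_I_mul] at h2
    have hm0 : 0 < |(m : ℝ)| := abs_pos.2 (by exact_mod_cast h0')
    rw [← div_eq_mul_inv, le_div_iff₀ (by positivity)]
    refine le_trans ?_ h2
    have hpi : 1 ≤ 2 * Real.pi := by linarith [Real.pi_gt_three]
    have := norm_nonneg (intervalCoeff (u 0) m)
    calc _ = 1 * |(m : ℝ)| * (1 * |(m : ℝ)| * ‖intervalCoeff (u 0) m‖) := by ring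
      _ ≤ _ := by gcongr
  have := has_pointwise_sum_fourier_series_of_summable hs (0 : ℝ)
  rw [hf] at this
  simp only [fourier_coe_apply] at this
  have h0 : f ((0 : ℝ) : AddCircle (1 : ℝ)) = (u 0 0 : ℂ) := rfl
  rw [h0] at this
  simpa using this

/-- The kernel solving the cohomological equation over the rotation by `a`, after regularization. -/
theorem exists_kernel {a : ℝ} (ha : IsDiophantine a) : ∃ (q : ℕ) (K : ℝ → ℝ), Continuous K ∧
    ∀ u : ℕ → ℝ → ℝ, (∀ j t, HasDerivAt (u j) (u (j + 1) t) t) → (∀ t, u 0 (t + 1) = u 0 t) →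
      (∫ t in (0 : ℝ)..1, K t * u q (a + t)) - ∫ t in (0 : ℝ)..1, K t * u q t =
        u 0 0 - ∫ t in (0 : ℝ)..1, u 0 t := by
  obtain ⟨C, hC, τ, hτ, hlow⟩ := lower_bound_exp ha
  -- The first summand pays for the small divisors; the other 2 makes the kernel's coefficients
  -- summable.
  let q : ℕ := ⌈τ⌉₊ + 2
  -- The `q` derivatives moved onto `u` are divided out again here. At `m = 0` the inverse of zero
  -- is zero, which drops the mean.
  let d : ℤ → ℂ := fun m =>
    ((2 * Real.pi * Complex.I * m) ^ q * (Complex.exp (2 * Real.pi * Complex.I * m * a) - 1))⁻¹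
  have hd : ∀ m, ‖d m‖ ≤ C⁻¹ * (|(m : ℝ)| ^ 2)⁻¹ := by
    intro m
    by_cases hm : m = 0
    · simp [d, hm, q]
    have hm1 : 1 ≤ |(m : ℝ)| := by exact_mod_cast Int.one_le_abs hm
    have hm0 : 0 < |(m : ℝ)| := by linarith
    simp only [d]
    rw [norm_inv, ← mul_inv, norm_mul, norm_pow, norm_two_pi_I_mul]
    refine inv_anti₀ (by positivity) ?_
    have hpi : 1 ≤ 2 * Real.pi := by linarith [Real.pi_gt_three]
    have h1 : 1 ≤ |(m : ℝ)| ^ (⌈τ⌉₊) * |(m : ℝ)| ^ (-τ) := by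
      rw [← Real.rpow_natCast, ← Real.rpow_add hm0]
      exact Real.one_le_rpow hm1 (by linarith [Nat.le_ceil τ])
    calc C * |(m : ℝ)| ^ 2 = 1 * (C * |(m : ℝ)| ^ 2) := by ring
      _ ≤ (|(m : ℝ)| ^ (⌈τ⌉₊) * |(m : ℝ)| ^ (-τ)) * (C * |(m : ℝ)| ^ 2) := by gcongr
      _ = (1 * |(m : ℝ)|) ^ q * (C * |(m : ℝ)| ^ (-τ)) := by simp only [q]; ring
      _ ≤ _ := by gcongr; exact hlow m hm
  let e : ℤ → ℝ → ℂ := fun m t => Complex.exp (-(2 * Real.pi * Complex.I * m * t))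
  have he : ∀ m t, ‖e m t‖ = 1 := by
    intro m t
    have h : -(2 * Real.pi * Complex.I * m * t) = ((-(2 * Real.pi * m * t) : ℝ) : ℂ) * Complex.I := by
      push_cast; ring
    simp only [e]
    rw [h, Complex.norm_exp_ofReal_mul_I]
  have hsum : Summable fun m : ℤ => C⁻¹ * (|(m : ℝ)| ^ 2)⁻¹ := summable_inv_sq_int.mul_left _
  have hde : ∀ m t, ‖d m * e m t‖ ≤ C⁻¹ * (|(m : ℝ)| ^ 2)⁻¹ := fun m t => by
    rw [norm_mul, he, mul_one]; exact hd m
  let κ : ℝ → ℂ := fun t => ∑' m, d m * e m t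
  have hκ : Continuous κ :=
    continuous_tsum (fun m => continuous_const.mul (continuous_character m)) hsum hde
  have hint : ∀ w : ℝ → ℝ, Continuous w →
      HasSum (fun m => d m * intervalCoeff w m) (∫ t in (0 : ℝ)..1, κ t * (w t : ℂ)) := by
    intro w hw
    have h := intervalIntegral.hasSum_integral_of_dominated_convergence (μ := volume) (a := 0) (b := 1)
      (F := fun (m : ℤ) t => d m * e m t * (w t : ℂ)) (f := fun t => κ t * (w t : ℂ))
      (fun (m : ℤ) t => C⁻¹ * (|(m : ℝ)| ^ 2)⁻¹ * ‖w t‖) ?_ ?_ ?_ ?_ ?_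
    · have e1 : (fun m => d m * intervalCoeff w m) =
          fun m => ∫ t in (0 : ℝ)..1, d m * e m t * (w t : ℂ) := by
        funext m
        unfold intervalCoeff
        rw [← intervalIntegral.integral_const_mul]
        simp only [e, mul_assoc]
      rw [e1]; exact h
    · exact fun m => ((continuous_const.mul (continuous_character m)).mul
        (Complex.continuous_ofReal.comp hw)).aestronglyMeasurable
    · refine fun m => Eventually.of_forall fun t _ => ?_
      rw [norm_mul, Complex.norm_real]
      gcongr; exact hde m t
    · exact Eventually.of_forall fun t _ => hsum.mul_right _
    · simp only [tsum_mul_right]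
      exact (continuous_const.mul hw.norm).intervalIntegrable _ _
    · exact Eventually.of_forall fun t _ => (Summable.of_norm_bounded hsum fun m => hde m t).hasSum.mul_right _
  refine ⟨q, fun t => (κ t).re, Complex.continuous_re.comp hκ, fun u hu hp => ?_⟩
  have hc : ∀ j, Continuous (u j) := fun j =>
    continuous_iff_continuousAt.2 fun t => (hu j t).continuousAt
  have hpj : ∀ j t, u j (t + 1) = u j t := by
    intro j
    induction j with
    | zero => exact hp
    | succ j ih =>
      intro t
      have h1 := (hu j (t + 1)).comp_add_const t 1
      simp only [ih] at h1
      exact h1.unique (hu j t)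
  have hcoef : ∀ j m, intervalCoeff (u j) m = (2 * Real.pi * Complex.I * m) ^ j * intervalCoeff (u 0) m := by
    intro j m
    induction j with
    | zero => simp
    | succ j ih => rw [intervalCoeff_deriv (hu j) (hc _) (hpj j), ih, pow_succ]; ring
  have hre : ∀ w : ℝ → ℝ, Continuous w →
      (∫ t in (0 : ℝ)..1, (κ t).re * w t) = (∫ t in (0 : ℝ)..1, κ t * (w t : ℂ)).re := by
    intro w hw
    have hi : IntervalIntegrable (fun t => κ t * (w t : ℂ)) volume 0 1 :=
      (hκ.mul (Complex.continuous_ofReal.comp hw)).intervalIntegrable _ _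
    have := Complex.reCLM.intervalIntegral_comp_comm hi
    simpa using this
  have hca : Continuous fun t => u q (a + t) := (hc q).comp (continuous_const.add continuous_id)
  rw [hre _ hca, hre _ (hc q), ← Complex.sub_re]
  have h1 := (hint _ hca).sub (hint _ (hc q))
  have h2 := (hasSum_intervalCoeff hu hp).sub (hasSum_ite_eq (0 : ℤ) (intervalCoeff (u 0) 0))
  have h3 : (fun m => d m * intervalCoeff (fun t => u q (a + t)) m - d m * intervalCoeff (u q) m) =
      fun m => intervalCoeff (u 0) m - if m = 0 then intervalCoeff (u 0) 0 else 0 := by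
    funext m
    by_cases hm : m = 0
    · simp [d, hm, q]
    have hm0 : (2 * Real.pi * Complex.I * m : ℂ) ≠ 0 := by
      simp [Real.pi_ne_zero, hm]
    have hx : Complex.exp (2 * Real.pi * Complex.I * m * a) - 1 ≠ 0 := by
      rw [← norm_pos_iff]
      refine lt_of_lt_of_le ?_ (hlow m hm)
      have : 0 < |(m : ℝ)| := abs_pos.2 (by exact_mod_cast hm)
      positivity
    rw [intervalCoeff_shift (hpj q), hcoef q, if_neg hm]
    simp only [d]
    field_simp
    ring
  rw [h3] at h1
  rw [h1.unique h2]
  have h4 : intervalCoeff (u 0) 0 = ((∫ t in (0 : ℝ)..1, u 0 t : ℝ) : ℂ) := by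
    simp [intervalCoeff, intervalIntegral.integral_ofReal]
  rw [h4]; simp

end Circle

/-! ### Functions invariant under `Γ` and killed by an ideal -/

section Admissible

variable {E : Type*} [NormedAddCommGroup E] [NormedSpace ℝ E]
  {N : Type*} [TopologicalSpace N] [ChartedSpace E N] [Group N] [LieGroup 𝓘(ℝ, E) ∞ N]

/-- Smooth functions on `N` invariant under left multiplication by `Γ` and killed by the
left-invariant derivatives in the directions of `V`. -/
structure Adm (Γ : Subgroup N) (V : Submodule ℝ E) (f : N → ℝ) : Prop where
  smooth : ContMDiff 𝓘(ℝ, E) 𝓘(ℝ, ℝ) ∞ f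
  left_inv : ∀ γ ∈ Γ, ∀ g, f (γ * g) = f g
  killed : ∀ W ∈ V, ∀ g, lderiv (E := E) f g W = 0

variable {Γ : Subgroup N} {V : Submodule ℝ E} {f f' : N → ℝ}

theorem Adm.mdiff (hf : Adm Γ V f) : MDifferentiable 𝓘(ℝ, E) 𝓘(ℝ, ℝ) f :=
  hf.smooth.mdifferentiable (by simp)

theorem Adm.mono {V' : Submodule ℝ E} (hf : Adm Γ V f) (h : V' ≤ V) : Adm Γ V' f :=
  ⟨hf.smooth, hf.left_inv, fun W hW => hf.killed W (h hW)⟩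

theorem Adm.const (x : ℝ) : Adm Γ V (fun _ => x) :=
  ⟨contMDiff_const, fun _ _ _ => rfl, fun W _ g => by rw [lderiv_const]; rfl⟩

theorem Adm.sub (hf : Adm Γ V f) (hf' : Adm Γ V f') : Adm Γ V (fun g => f g - f' g) where
  smooth := hf.smooth.sub hf'.smooth
  left_inv γ hγ g := by rw [hf.left_inv γ hγ, hf'.left_inv γ hγ]
  killed W hW g := by
    rw [lderiv_sub (hf.mdiff g) (hf'.mdiff g)]
    simp [hf.killed W hW, hf'.killed W hW]

theorem Adm.add (hf : Adm Γ V f) (hf' : Adm Γ V f') : Adm Γ V (fun g => f g + f' g) := by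
  simpa using hf.sub ((Adm.const 0).sub hf')

theorem Adm.comp_mul_right (hAd : ∀ h : N, ∀ W ∈ V, Ad h W ∈ V) (hf : Adm Γ V f) (h : N) :
    Adm Γ V (fun g => f (g * h)) where
  smooth := hf.smooth.comp contMDiff_mul_right
  left_inv γ hγ g := by rw [mul_assoc, hf.left_inv γ hγ]
  killed W hW g := by
    rw [lderiv_comp_mul_right (hf.mdiff _)]
    exact hf.killed _ (hAd _ W hW) _

variable [FiniteDimensional ℝ E] [T2Space N]

variable (N) in
/-- The exponential map on the model space of the Lie algebra. -/
noncomputable def expE (W : E) : N := lieExp (N := N) W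

variable (N) in
/-- The one-parameter subgroup generated by a vector of the model space of the Lie algebra. -/
noncomputable def ray (W : E) (t : ℝ) : N := expE N (t • W)

theorem ray_zero (W : E) : ray N W 0 = 1 := oneParam_zero (N := N) (E := E) W

theorem ray_one (W : E) : ray N W 1 = expE N W := oneParam_one (N := N) (E := E) W

theorem ray_add (W : E) (s t : ℝ) : ray N W (s + t) = ray N W s * ray N W t :=
  oneParam_add (N := N) (E := E) W s t

theorem continuous_ray (W : E) : Continuous (ray N W) := continuous_oneParam (N := N) (E := E) W

theorem expE_zero : expE N (0 : E) = 1 := by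
  simpa [ray] using ray_zero (N := N) (0 : E)

theorem hasDerivAt_comp_ray {f : N → ℝ} (hf : MDifferentiable 𝓘(ℝ, E) 𝓘(ℝ, ℝ) f) (W : E) (g : N)
    (s : ℝ) : HasDerivAt (fun s => f (g * ray N W s)) (lderiv (E := E) f (g * ray N W s) W) s :=
  hasDerivAt_comp_oneParam hf W g s

theorem comp_expE_mul_eq {f : N → ℝ} (hf : ContMDiff 𝓘(ℝ, E) 𝓘(ℝ, ℝ) ∞ f)
    (hV : ∀ W ∈ V, ∀ g, lderiv (E := E) f g W = 0) (A B : E) (hAB : ∀ h : N, Ad h A - B ∈ V)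
    (g h : N) : f (g * expE N A * h) = f (g * h * expE N B) :=
  comp_lieExp_mul_eq hf hV A B hAB g h

/-- The case `B = 0` of `comp_expE_mul_eq`: a factor from `exp V` disappears wherever it stands. -/
theorem Adm.comp_expE_mul (hAd : ∀ h : N, ∀ W ∈ V, Ad h W ∈ V) (hf : Adm Γ V f) {W : E}
    (hW : W ∈ V) (g h : N) : f (g * expE N W * h) = f (g * h) := by
  have := comp_expE_mul_eq hf.smooth hf.killed W 0 (fun h => by simpa using hAd h W hW) g h
  rw [this]
  rw [expE_zero, mul_one]

theorem lderiv_eq_zero_of_comp_ray (hf : ContMDiff 𝓘(ℝ, E) 𝓘(ℝ, ℝ) ∞ f) {W : E} {g : N}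
    (h : ∀ t, f (g * ray N W t) = f g) : lderiv (E := E) f g W = 0 := by
  have h1 := hasDerivAt_comp_ray (hf.mdifferentiable (by simp)) W g 0
  have h2 : (fun t => f (g * ray N W t)) = fun _ => f g := funext h
  rw [h2, ray_zero, mul_one] at h1
  exact h1.unique (hasDerivAt_const 0 _)

theorem lderiv_eq_zero_of_comp_expE (hf : ContMDiff 𝓘(ℝ, E) 𝓘(ℝ, ℝ) ∞ f)
    (h : ∀ W ∈ V, ∀ g, f (g * expE N W) = f g) (W : E) (hW : W ∈ V) (g : N) :
    lderiv (E := E) f g W = 0 :=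
  lderiv_eq_zero_of_comp_ray hf fun t => h _ (V.smul_mem t hW) g

theorem Adm.lderiv (hAd : ∀ h : N, ∀ W ∈ V, Ad h W ∈ V) (hf : Adm Γ V f) (X : E) :
    Adm Γ V (fun g => lderiv f g X) := by
  have hs : ContMDiff 𝓘(ℝ, E) 𝓘(ℝ, ℝ) ∞ (fun g => DiophantineLattice.lderiv f g X) := fun g =>
    (contMDiffAt_lderiv (hf.smooth g)).clm_apply contMDiffAt_const
  refine ⟨hs, fun γ hγ g => ?_, lderiv_eq_zero_of_comp_expE hs fun W hW g => ?_⟩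
  · rw [← lderiv_comp_mul_left]
    simp only [hf.left_inv γ hγ]
  · unfold DiophantineLattice.lderiv
    simp only [hf.comp_expE_mul hAd hW]

theorem Adm.integral (hAd : ∀ h : N, ∀ W ∈ V, Ad h W ∈ V) (hf : Adm Γ V f) {K : ℝ → ℝ}
    (hK : Continuous K) {e : ℝ → N} (he : Continuous e) :
    Adm Γ V (fun g => ∫ t in (0 : ℝ)..1, K t * f (g * e t)) := by
  have hs := contMDiff_integral hf.smooth hK he
  refine ⟨hs, fun γ hγ g => ?_, lderiv_eq_zero_of_comp_expE hs fun W hW g => ?_⟩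
  · simp only [mul_assoc, hf.left_inv γ hγ]
  · simp only [hf.comp_expE_mul hAd hW]

/-! ### Enlarging `V` by a vector central modulo `V` -/

section Step

variable {X : E}

theorem Adm.sup (hf : Adm Γ V f) (h : ∀ g t, f (g * ray N X t) = f g) :
    Adm Γ (V ⊔ Submodule.span ℝ {X}) f := by
  refine ⟨hf.smooth, hf.left_inv, fun W hW g => ?_⟩
  obtain ⟨v, hv, w, hw, rfl⟩ := Submodule.mem_sup.1 hW
  obtain ⟨c, rfl⟩ := Submodule.mem_span_singleton.1 hw
  rw [map_add, map_smul, hf.killed v hv, lderiv_eq_zero_of_comp_ray hf.smooth (h g)]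
  simp

theorem Ad_mem_sup (hAd : ∀ h : N, ∀ W ∈ V, Ad h W ∈ V) (hX : ∀ h : N, Ad h X - X ∈ V) (h : N) (W : E)
    (hW : W ∈ V ⊔ Submodule.span ℝ {X}) : Ad h W ∈ V ⊔ Submodule.span ℝ {X} := by
  obtain ⟨v, hv, w, hw, rfl⟩ := Submodule.mem_sup.1 hW
  obtain ⟨c, rfl⟩ := Submodule.mem_span_singleton.1 hw
  rw [map_add, map_smul]
  refine add_mem (Submodule.mem_sup_left (hAd h v hv)) (Submodule.smul_mem _ c ?_)
  rw [← sub_add_cancel (Ad h X) X]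
  exact add_mem (Submodule.mem_sup_left (hX h)) (Submodule.mem_sup_right (Submodule.mem_span_singleton_self X))

theorem Adm.comp_ray_mul (hf : Adm Γ V f) (hX : ∀ h : N, Ad h X - X ∈ V) (t : ℝ) (g h : N) :
    f (g * ray N X t * h) = f (g * h * ray N X t) :=
  comp_expE_mul_eq hf.smooth hf.killed (t • X) (t • X)
    (fun h => by rw [map_smul, ← smul_sub]; exact V.smul_mem t (hX h)) g h

/-- Being central for `f`, the factor `exp X` moves to the far left, where `Γ` absorbs it. -/
theorem Adm.comp_ray_add_one (hf : Adm Γ V f) (hX : ∀ h : N, Ad h X - X ∈ V)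
    (hΓ : expE N X ∈ Γ) (g : N) (t : ℝ) :
    f (g * ray N X (t + 1)) = f (g * ray N X t) := by
  rw [ray_add, ← mul_assoc, ← one_mul (g * ray N X t),
    ← hf.comp_ray_mul hX, ray_one, one_mul, hf.left_inv _ hΓ, one_mul]

theorem Adm.comp_mul_expE (hf : Adm Γ V f) {Y : E} {a : ℝ} (hY : ∀ h : N, Ad h Y - a • X ∈ V) (g : N) :
    f (g * expE N Y) = f (g * ray N X a) := by
  have := comp_expE_mul_eq hf.smooth hf.killed Y (a • X) hY g 1
  simpa only [mul_one, ray] using this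

theorem Adm.continuous_comp_ray (hf : Adm Γ V f) (g : N) :
    Continuous fun t => f (g * ray N X t) :=
  hf.smooth.continuous.comp
    ((contMDiff_mul_left (I := 𝓘(ℝ, E)) (n := ∞)).continuous.comp (continuous_ray _))

theorem Adm.integral_comp_ray_add (hf : Adm Γ V f) (hX : ∀ h : N, Ad h X - X ∈ V)
    (hΓ : expE N X ∈ Γ) (g : N) (s : ℝ) :
    ∫ t in (0 : ℝ)..1, f (g * ray N X s * ray N X t) =
      ∫ t in (0 : ℝ)..1, f (g * ray N X t) := by
  have hp : Function.Periodic (fun t => f (g * ray N X t)) 1 := fun t =>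
    hf.comp_ray_add_one hX hΓ g t
  have h1 := hp.intervalIntegral_add_eq 0 s
  have h2 := intervalIntegral.integral_comp_add_left (a := 0) (b := 1)
    (fun t => f (g * ray N X t)) s
  simp only [ray_add, ← mul_assoc, add_zero, zero_add] at h1 h2
  rw [h2, h1]

theorem Adm.average (hAd : ∀ h : N, ∀ W ∈ V, Ad h W ∈ V) (hf : Adm Γ V f)
    (hX : ∀ h : N, Ad h X - X ∈ V) (hΓ : expE N X ∈ Γ) :
    Adm Γ (V ⊔ Submodule.span ℝ {X})
      (fun g => ∫ t in (0 : ℝ)..1, f (g * ray N X t)) := by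
  have h := hf.integral hAd (K := fun _ => 1) continuous_const (continuous_ray X)
  simp only [one_mul] at h
  exact h.sup fun g t => hf.integral_comp_ray_add hX hΓ g t

theorem Adm.sup_of_comp_mul_expE (hf : Adm Γ V f) (hX : ∀ h : N, Ad h X - X ∈ V)
    (hΓ : expE N X ∈ Γ) {Y : E} {a : ℝ} (ha : Irrational a)
    (hY : ∀ h : N, Ad h Y - a • X ∈ V) (h : ∀ g, f (g * expE N Y) = f g) :
    Adm Γ (V ⊔ Submodule.span ℝ {X}) f := by
  refine hf.sup fun g t => ?_
  have := eq_of_periodic_irrational ha (hf.continuous_comp_ray (X := X) g)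
    (hf.comp_ray_add_one hX hΓ g) (fun t => by
      rw [ray_add, ← mul_assoc, ← hf.comp_mul_expE hY, h]) t
  rwa [ray_zero, mul_one] at this

/-- The cohomological equation over a Diophantine rotation of the central circle fibres. -/
theorem Adm.exists_coboundary (hAd : ∀ h : N, ∀ W ∈ V, Ad h W ∈ V) (hf : Adm Γ V f)
    (hX : ∀ h : N, Ad h X - X ∈ V)
    (hΓ : expE N X ∈ Γ) {Y : E} {a : ℝ} (ha : IsDiophantine a)
    (hY : ∀ h : N, Ad h Y - a • X ∈ V) :
    ∃ P : N → ℝ, Adm Γ V P ∧ ∀ g, P (g * expE N Y) - P g =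
      f g - ∫ t in (0 : ℝ)..1, f (g * ray N X t) := by
  obtain ⟨q, K, hK, hker⟩ := exists_kernel ha
  let D : ℕ → N → ℝ := fun j => (fun f g => DiophantineLattice.lderiv (E := E) f g X)^[j] f
  have hD0 : D 0 = f := rfl
  have hDs : ∀ j, D (j + 1) = fun g => DiophantineLattice.lderiv (E := E) (D j) g X := fun j =>
    Function.iterate_succ_apply' _ j f
  have hD : ∀ j, Adm Γ V (D j) := by
    intro j
    induction j with
    | zero => exact hf
    | succ j ih => rw [hDs]; exact ih.lderiv hAd X
  -- The solution is `P(g) = ∫ K(t) (X^q f)(g exp(tX)) dt`. Translating by `exp Y` shifts the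
  -- argument of `X^q f` by `a`, as in `exists_kernel`.
  have hP := (hD q).integral hAd hK (continuous_ray X)
  refine ⟨_, hP, fun g => ?_⟩
  rw [hP.comp_mul_expE hY]
  have h := hker (fun j t => D j (g * ray N X t)) (fun j t => by
      rw [hDs]; exact hasDerivAt_comp_ray (hD j).mdiff X g t)
    (fun t => (hD 0).comp_ray_add_one hX hΓ g t)
  simp only [ray_add, ← mul_assoc] at h
  rw [h, hD0, ray_zero, mul_one]

/-- A cocycle of functions killed by `V` is cohomologous to one of functions killed by `V + ℝ X`. -/
theorem exists_cohomologous_sup (hAd : ∀ h : N, ∀ W ∈ V, Ad h W ∈ V) (hX : ∀ h : N, Ad h X - X ∈ V)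
    (hΓ : expE N X ∈ Γ) {Y : E} {a : ℝ} (ha : IsDiophantine a)
    (hY : ∀ h : N, Ad h Y - a • X ∈ V) {Λ : Subgroup N} [Group.IsNilpotent Λ]
    (hΛ : expE N Y ∈ Λ) (c : N → Λ → ℝ) (hc : ∀ l, Adm Γ V fun g => c g l)
    (hcc : ∀ g (l l' : Λ), c g (l * l') = c g l + c (g * l) l') :
    ∃ P : N → ℝ, Adm Γ V P ∧
      ∀ l : Λ, Adm Γ (V ⊔ Submodule.span ℝ {X}) fun g => c g l + P g - P (g * l) := by
  let y : Λ := ⟨expE N Y, hΛ⟩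
  obtain ⟨P, hP, hPe⟩ := (hc y).exists_coboundary hAd hX hΓ ha hY
  have hAd' := Ad_mem_sup hAd hX
  let b : N → Λ → ℝ := fun g l => c g l + P g - P (g * l)
  have hbm : ∀ g (l l' : Λ), b g (l * l') = b g l + b (g * l) l' := fun g l l' => by
    simp only [b, hcc, Subgroup.coe_mul, mul_assoc]; ring
  have hb : ∀ l, Adm Γ V fun g => b g l := fun l =>
    ((hc l).add hP).sub (hP.comp_mul_right hAd l)
  have hby : Adm Γ (V ⊔ Submodule.span ℝ {X}) fun g => b g y := by
    have h := (hc y).average hAd hX hΓ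
    refine (congrArg _ (funext fun g => ?_)).mp h
    have := hPe g
    change _ = c g y + P g - P (g * expE N Y)
    linarith
  obtain ⟨m, hm⟩ := Subgroup.nilpotent_iff_lowerCentralSeries.1 (inferInstance : Group.IsNilpotent Λ)
  -- Induction from the trivial bottom term upwards; `j` is the distance from the bottom.
  have key : ∀ j k, k + j = m → ∀ l ∈ (⊤ : Subgroup Λ).lowerCentralSeries k,
      Adm Γ (V ⊔ Submodule.span ℝ {X}) fun g => b g l := by
    intro j
    induction j with
    | zero =>
      rintro k hk l hl
      rw [add_zero] at hk
      rw [hk, hm, Subgroup.mem_bot] at hl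
      have : (fun g => b g l) = fun _ => 0 := by
        funext g
        have := hbm g 1 1
        rw [hl]
        simpa using this
      rw [this]; exact Adm.const 0
    | succ j ih =>
      intro k hk l hl
      have hμ : (l⁻¹ * y⁻¹ * l * y) ∈ (⊤ : Subgroup Λ).lowerCentralSeries (k + 1) :=
        by simpa [commutatorElement_def] using
          Subgroup.commutator_mem_commutator (Subgroup.inv_mem _ hl) (Subgroup.mem_top y⁻¹)
      have hbμ := ih (k + 1) (by omega) _ hμ
      have hcomm : l * y = y * l * (l⁻¹ * y⁻¹ * l * y) := by
        group
      let G : N → ℝ := fun g => b (g * y) l - b g l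
      have hG : Adm Γ (V ⊔ Submodule.span ℝ {X}) G := by
        have h := (hby.comp_mul_right hAd' l).sub hby |>.sub (hbμ.comp_mul_right hAd' (y * l))
        refine (congrArg _ (funext fun g => ?_)).mp h
        have h1 := hbm g l y
        rw [hcomm, hbm, hbm] at h1
        simp only [G, Subgroup.coe_mul, mul_assoc] at h1 ⊢
        linarith
      have hGX : ∀ g t, G (g * ray N X t) = G g := by
        intro g t
        have h := hG.comp_expE_mul hAd' (W := t • X)
          (Submodule.mem_sup_right (Submodule.smul_mem _ t (Submodule.mem_span_singleton_self X))) g 1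
        simpa only [mul_one, ray] using h
      -- `G` equals its own fibre average. That average is zero, because `y` only rotates the fibre
      -- and both terms of `G` have the same integral.
      have hG0 : ∀ g, G g = 0 := by
        intro g
        have h1 : ∫ t in (0 : ℝ)..1, G (g * ray N X t) = G g := by
          simp [hGX]
        have h2 : ∀ t, G (g * ray N X t) =
            b (g * ray N X a * ray N X t) l -
              b (g * ray N X t) l := by
          intro t
          simp only [G]
          congr 1
          refine ((hb l).comp_mul_expE hY _).trans ?_
          simp only [mul_assoc, ← ray_add, add_comm]
        simp only [h2] at h1
        rw [intervalIntegral.integral_sub ((hb l).continuous_comp_ray _ |>.intervalIntegrable _ _)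
          ((hb l).continuous_comp_ray _ |>.intervalIntegrable _ _),
          (hb l).integral_comp_ray_add hX hΓ, sub_self] at h1
        exact h1.symm
      exact (hb l).sup_of_comp_mul_expE hX hΓ ha.irrational hY fun g => sub_eq_zero.1 (hG0 g)
  exact ⟨P, hP, fun l => key m 0 (by omega) l (Subgroup.mem_top _)⟩

end Step

end Admissible

/-! ### Induction along the Malcev flag -/

section Main

variable {E : Type*} [NormedAddCommGroup E] [NormedSpace ℝ E]

/-- On the line `(V + ℝX)/V` the map `A` is a scalar `c`. Nilpotence of `A - 1` gives `(c - 1)^m =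
0`, so `c = 1`. -/
theorem map_sub_self_mem_of_pow_eq_zero {V : Submodule ℝ E} {X : E} (hX : X ∉ V) {A : E →L[ℝ] E}
    {m : ℕ} (hA : (A - 1) ^ m = 0) (hV : ∀ W ∈ V, A W ∈ V)
    (hVX : ∀ W ∈ V ⊔ Submodule.span ℝ {X}, A W ∈ V ⊔ Submodule.span ℝ {X}) : A X - X ∈ V := by
  obtain ⟨v, hv, w, hw, hAX⟩ := Submodule.mem_sup.1
    (hVX X (Submodule.mem_sup_right (Submodule.mem_span_singleton_self X)))
  obtain ⟨c, rfl⟩ := Submodule.mem_span_singleton.1 hw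
  have hT : ∀ j, ((A - 1) ^ j) X - (c - 1) ^ j • X ∈ V := by
    intro j
    induction j with
    | zero => simp
    | succ j ih =>
      have h : ((A - 1) ^ (j + 1)) X - (c - 1) ^ (j + 1) • X =
          (A (((A - 1) ^ j) X - (c - 1) ^ j • X) - (((A - 1) ^ j) X - (c - 1) ^ j • X)) +
            (c - 1) ^ j • v := by
        rw [pow_succ' (A - 1)]
        simp only [mul_apply_eq_comp, _root_.sub_apply,
          one_apply_eq_self, map_sub, map_smul, ← hAX]
        module
      rw [h]
      exact add_mem (sub_mem (hV _ ih) ih) (V.smul_mem _ hv)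
  have hc : c = 1 := by
    by_contra hc
    have h := hT m
    rw [hA, _root_.zero_apply, zero_sub, neg_mem_iff] at h
    exact hX ((V.smul_mem_iff (pow_ne_zero m (sub_ne_zero.2 hc))).1 h)
  rwa [← hAX, hc, one_smul, add_sub_cancel_right]

/-- The span of the first `k` vectors of a family. -/
def initSpan {n : ℕ} (X : Fin n → E) (k : ℕ) : Submodule ℝ E :=
  Submodule.span ℝ (X '' {j | j.val < k})

section initSpan

variable {n : ℕ} (X : Fin n → E)

theorem initSpan_zero : initSpan X 0 = ⊥ := by simp [initSpan]

theorem initSpan_top : initSpan X n = Submodule.span ℝ (Set.range X) := by simp [initSpan]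

theorem initSpan_succ (k : Fin n) :
    initSpan X (k + 1) = initSpan X k ⊔ Submodule.span ℝ {X k} := by
  have h : {j : Fin n | j.val < k + 1} = insert k {j : Fin n | j.val < k} := by
    ext j; simp only [mem_ofPred_eq, mem_insert_iff, Fin.ext_iff]; omega
  rw [initSpan, h, Set.image_insert_eq, Submodule.span_insert, sup_comm]; rfl

theorem initSpan_succ_eq (k : Fin n) :
    initSpan X (k + 1) = Submodule.span ℝ (X '' Set.Iic k) := by
  have h : {j : Fin n | j.val < k + 1} = Set.Iic k := by
    ext j; simp only [mem_ofPred_eq, mem_Iic, Fin.le_def]; omega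
  rw [initSpan, h]

variable {X}

theorem notMem_initSpan (hX : LinearIndependent ℝ X) (k : Fin n) : X k ∉ initSpan X k := fun h => by
  simpa using hX.notMem_span_image (s := {j : Fin n | j.val < k}) (x := k) (by simp) h

theorem sum_sub_mem_initSpan (k : Fin n) (a : Fin n → ℝ) :
    ∑ j ∈ Finset.Iic k, a j • X j - a k • X k ∈ initSpan X k := by
  rw [← Finset.sum_erase_eq_sub (by simp)]
  refine Submodule.sum_mem _ fun j hj => Submodule.smul_mem _ _ (Submodule.subset_span ⟨j, ?_, rfl⟩)
  rw [Finset.mem_erase, Finset.mem_Iic] at hj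
  exact lt_of_le_of_ne hj.2 fun h => hj.1 h

end initSpan

variable {N : Type*} [TopologicalSpace N] [ChartedSpace E N] [Group N] [LieGroup 𝓘(ℝ, E) ∞ N]
  [FiniteDimensional ℝ E] [T2Space N]

theorem prod_ofFn_eq_of_eq_one {M : Type*} [Monoid M] {n : ℕ} (f : Fin n → M) (k : Fin n)
    (hf : ∀ i, i ≠ k → f i = 1) : (List.ofFn f).prod = f k := by
  induction n with
  | zero => exact k.elim0
  | succ n ih =>
    rw [List.ofFn_succ, List.prod_cons]
    refine Fin.cases (fun hf => ?_) (fun i hf => ?_) k hf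
    · have : (fun i : Fin n => f i.succ) = fun _ => 1 := funext fun i => hf _ (Fin.succ_ne_zero i)
      rw [this]; simp
    · rw [hf 0 (Fin.succ_ne_zero i).symm, one_mul]
      exact ih _ i fun j hj => hf _ fun h => hj (Fin.succ_injective n h)

theorem IsStronglyBasedOn.lieExp_mem {n : ℕ} {X : Module.Basis (Fin n) ℝ (GroupLieAlgebra 𝓘(ℝ, E) N)}
    {Γ : Subgroup N} (h : IsStronglyBasedOn X Γ) (k : Fin n) : lieExp (X k) ∈ Γ := by
  rw [← SetLike.mem_coe, h.eq_prod]
  refine ⟨Pi.single k 1, ?_⟩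
  change (List.ofFn fun i => lieExp (((Pi.single k (1 : ℤ) : Fin n → ℤ) i : ℝ) • X i)).prod = _
  rw [prod_ofFn_eq_of_eq_one _ k fun i hi => ?_]
  · simp
  · rw [Pi.single_eq_of_ne hi, Int.cast_zero]
    exact oneParam_zero (X i)

theorem Ad_mem_initSpan [PreconnectedSpace N] {n : ℕ} {X : Fin n → E}
    (hX : ∀ i : Fin n, ∀ Z : E, ∀ W ∈ Submodule.span ℝ (X '' Set.Iic i),
      lieModel N Z W ∈ Submodule.span ℝ (X '' Set.Iic i)) {k : ℕ}
    (hk : k ≤ n) (g : N) (W : E) (hW : W ∈ initSpan X k) : Ad g W ∈ initSpan X k := by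
  cases k with
  | zero =>
    rw [initSpan_zero, Submodule.mem_bot] at hW ⊢
    rw [hW, map_zero]
  | succ k =>
    rw [initSpan_succ_eq X ⟨k, hk⟩] at hW ⊢
    exact Ad_mem_of_ideal (hX ⟨k, hk⟩) g hW

theorem Ad_sub_mem_initSpan [PreconnectedSpace N] [Group.IsNilpotent N] {n : ℕ} {X : Fin n → E}
    (hX : ∀ i : Fin n, ∀ Z : E, ∀ W ∈ Submodule.span ℝ (X '' Set.Iic i),
      lieModel N Z W ∈ Submodule.span ℝ (X '' Set.Iic i)) (hli : LinearIndependent ℝ X)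
    (k : Fin n) (g : N) : Ad g (X k) - X k ∈ initSpan X k := by
  obtain ⟨m, hm⟩ := exists_Ad_sub_id_pow_eq_zero (E := E) (N := N)
  refine map_sub_self_mem_of_pow_eq_zero (notMem_initSpan hli k) (hm g)
    (Ad_mem_initSpan hX k.2.le g) ?_
  rw [← initSpan_succ X k]
  exact Ad_mem_initSpan hX k.2 g

/-- A cocycle over the right translations by `Λ` of smooth left `Γ`-invariant functions is
cohomologous to a cocycle of functions killed by all left-invariant derivatives. -/
theorem exists_cohomologous_top [PreconnectedSpace N] [Group.IsNilpotent N] {Γ Λ : Subgroup N}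
    {n : ℕ} (X : Module.Basis (Fin n) ℝ E) (Y : Fin n → E) (a : Fin n → Fin n → ℝ)
    (hX : ∀ i : Fin n, ∀ Z : E, ∀ W ∈ Submodule.span ℝ (X '' Set.Iic i),
      lieModel N Z W ∈ Submodule.span ℝ (X '' Set.Iic i))
    (hΓ : ∀ i, expE N (X i) ∈ Γ) (hΛ : ∀ i, expE N (Y i) ∈ Λ)
    (hYX : ∀ i, Y i = ∑ j ∈ Finset.Iic i, a i j • X j) (ha : ∀ i, IsDiophantine (a i i))
    (c : N → Λ → ℝ) (hc : ∀ l, Adm (E := E) Γ ⊥ fun g => c g l)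
    (hcc : ∀ g (l l' : Λ), c g (l * l') = c g l + c (g * l) l') :
    ∃ P : N → ℝ, Adm (E := E) Γ ⊥ P ∧
      ∀ l : Λ, Adm (E := E) Γ ⊤ fun g => c g l + P g - P (g * l) := by
  have key : ∀ k ≤ n, ∃ P : N → ℝ, Adm (E := E) Γ ⊥ P ∧
      ∀ l : Λ, Adm Γ (initSpan X k) fun g => c g l + P g - P (g * l) := by
    intro k
    induction k with
    | zero =>
      refine fun _ => ⟨fun _ => 0, Adm.const 0, fun l => ?_⟩
      simpa [initSpan_zero] using hc l
    | succ k ih =>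
      intro hk
      obtain ⟨P, hP, hPc⟩ := ih (by omega)
      let i : Fin n := ⟨k, hk⟩
      have hAd := Ad_mem_initSpan hX (show k ≤ n by omega)
      have hAdX : ∀ h : N, Ad h (X i) - X i ∈ initSpan X k :=
        Ad_sub_mem_initSpan hX X.linearIndependent i
      have hYi : Y i - a i i • X i ∈ initSpan X k := by
        rw [hYX i]
        exact sum_sub_mem_initSpan i (a i)
      have hAdY : ∀ h : N, Ad h (Y i) - a i i • X i ∈ initSpan X k := by
        intro h
        -- `Y i` differs from `a i i • X i` by an element of the invariant subspace, and `X i` is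
        -- itself fixed modulo that subspace.
        have e : Ad h (Y i) - a i i • X i =
            Ad h (Y i - a i i • X i) + a i i • (Ad h (X i) - X i) := by
          rw [map_sub, map_smul, smul_sub]; abel
        rw [e]
        exact add_mem (hAd h _ hYi) (Submodule.smul_mem _ _ (hAdX h))
      obtain ⟨Q, hQ, hQc⟩ := exists_cohomologous_sup hAd hAdX (hΓ i) (ha i) hAdY (hΛ i) _ hPc
        fun g l l' => by simp only [hcc, Subgroup.coe_mul, mul_assoc]; ring
      refine ⟨fun g => P g + Q g, hP.add (hQ.mono bot_le), fun l => ?_⟩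
      rw [initSpan_succ X i]
      refine (congrArg _ (funext fun g => ?_)).mp (hQc l)
      ring
  obtain ⟨P, hP, hPc⟩ := key n le_rfl
  refine ⟨P, hP, fun l => ?_⟩
  have := hPc l
  rwa [initSpan_top, X.span_eq] at this

end Main

end DiophantineLattice

theorem mainTheorem3
    {E : Type*} [NormedAddCommGroup E] [NormedSpace ℝ E] [FiniteDimensional ℝ E]
    {N : Type*} [TopologicalSpace N] [T2Space N] [ChartedSpace E N] [Group N]
    [LieGroup 𝓘(ℝ, E) ∞ N] [SimplyConnectedSpace N] [Group.IsNilpotent N]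
    (Γ Λ : Subgroup N)
    (hΓ : DiophantineLattice.IsLattice Γ) (hΛ : DiophantineLattice.IsLattice Λ)
    (hDioph : DiophantineLattice.IsDiophantineWrt E Λ Γ)
    (c : DiophantineLattice.CosetSpace Γ → Λ → ℝ)
    (hc : DiophantineLattice.IsSmoothCocycle E Γ Λ c) :
    ∃ φ : Additive Λ →+ ℝ,
      DiophantineLattice.Cohomologous E Γ Λ c (fun _ l => φ (Additive.ofMul l)) := by
  have hproj : ∀ γ ∈ Γ, ∀ g : N,
      DiophantineLattice.proj Γ (γ * g) = DiophantineLattice.proj Γ g := fun γ hγ g =>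
    Quotient.sound ⟨⟨γ, hγ⟩, rfl⟩
  obtain ⟨n, X, Y, a, hX, hY, hYX, ha⟩ := hDioph
  obtain ⟨P, hP, hPc⟩ := DiophantineLattice.exists_cohomologous_top (E := E) X Y a
    hX.isStrongMalcevBasis hX.lieExp_mem hY.lieExp_mem hYX ha
    (fun g l => c (DiophantineLattice.proj Γ g) l)
    (fun l => ⟨hc.smooth l, fun γ hγ g => by rw [hproj γ hγ g], fun W hW g => by
      rw [(Submodule.mem_bot ℝ).1 hW, map_zero]⟩)
    (fun g l l' => hc.map_mul _ l l')
  -- All invariant derivatives vanish, so on the connected group the corrected cocycle equals its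
  -- value at the identity; that value defines `φ`.
  have hconst : ∀ (l : Λ) (g : N), c (DiophantineLattice.proj Γ g) l + P g - P (g * l) =
      c (DiophantineLattice.proj Γ 1) l + P 1 - P (1 * l) := fun l =>
    DiophantineLattice.eq_of_lderiv_eq_zero (hPc l).smooth fun g =>
      ContinuousLinearMap.ext fun W => (hPc l).killed W trivial g
  refine ⟨AddMonoidHom.mk' (fun l => c (DiophantineLattice.proj Γ 1) l.toMul + P 1 - P (1 * l.toMul))
    fun l l' => ?_, Quotient.lift P ?_, hP.smooth, fun x l => ?_⟩
  · have h1 := hc.map_mul (DiophantineLattice.proj Γ 1) l.toMul l'.toMul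
    have h2 := hconst l'.toMul (1 * l.toMul)
    change c (DiophantineLattice.proj Γ (1 * l.toMul)) _ + _ - _ = _ at h2
    change _ = _ + c (DiophantineLattice.proj Γ (1 * l.toMul)) _ at h1
    simp only [toMul_add, h1, Subgroup.coe_mul, ← mul_assoc] at h2 ⊢
    linarith
  · rintro _ g ⟨γ, rfl⟩
    exact hP.left_inv γ γ.2 g
  · induction x using Quotient.inductionOn with
    | _ g =>
      have h := hconst l g
      change c (DiophantineLattice.proj Γ g) l = -P g +
        (c (DiophantineLattice.proj Γ 1) l + P 1 - P (1 * l)) + P (g * l)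
      linarith
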